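/- Let $d,k\in\mathbb N$, let $G\subset\mathbb R^d$ be a bounded domain (nonempty, open, connected), and let $T>0$, $\tau>0$. Equip $\mathbb R^{k\times d}$ with the Frobenius inner product $D:\hat D$; let $\mathcal S$ be the space of tensors $H=(H_{ijIJ})\in\mathbb R^{(k\times d)\times(k\times d)}$ with $H_{ijIJ}=H_{IJij}$, acting on $\mathbb R^{k\times d}$ by $(HD)_{ij}=\sum_{I,J}H_{ijIJ}D_{IJ}$, and for $\kappa\ge 0$ let $\mathcal S_{\ge\kappa}$ be the set of $H\in\mathcal S$ with $(HD):D\ge\kappa\,(D:D)$ for all $D$. Let $F:\mathbb R^{k\times d}\to\mathcal S_{\ge 0}$ be weakly differentiable with $F$ and its weak Jacobian essentially bounded ($F$ being identified with its continuous representative). Put $\mathcal H=\{u\in L^2(G,\mathbb R^k):\int_G u\,dx=0\}$ and $\mathcal V=H^1(G,\mathbb R^k)\cap\mathcal H$, with the Gelfand triple $\mathcal V\hookrightarrow\mathcal H\hookrightarrow\mathcal V'$, and for $H\in L^\infty(G,\mathcal S)$ define $\mathcal A(H):\mathcal V\to\mathcal V'$ by $\langle\mathcal A(H)u,v\rangle=\int_G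 (H\nabla u):\nabla v\,dx$. Let $u^0\in\mathcal H$ and $H^0\in L^\infty(G,\mathcal S)$. A weak solution on $[0,T]$ is a pair $(u,H)$ with $$u\in H^1(0,T;\mathcal V')\cap L^2(0,T;\mathcal V),\qquad H\in H^1(0,T;L^\infty(G,\mathcal S)),$$ such that for some $\kappa>0$ one has $H\in\mathcal S_{\ge\kappa}$ a.e. in $(0,T)\times G$, and such that $$\partial_t u+\mathcal A(H)u=0\ \text{ in } L^2(0,T;\mathcal V'),\qquad \tau\,\partial_t H+H-F(\nabla u)=0\ \text{ in } L^2(0,T;L^\infty(G,\mathcal S)),$$ $$u(0,\cdot)=u^0\ \text{ in }\mathcal H,\qquad H(0,\cdot)=H^0\ \text{ in } L^\infty(G,\mathcal S),$$ where the initial values are those of the representatives in $C([0,T],\mathcal H)$ and $C([0,T],L^\infty(G,\mathcal S))$. **Theorem.** Let $(u_1,H_1)$ and $(u_2,H_2)$ be two weak solutions on $[0,T]$ (for the same $F,\tau,u^0,H^0$) such that $\nabla u_1,\nabla u_2\in L^\infty((0,T)\times G,\mathbb R^{k\times d})$. Then $u_1=u_2$ and $H_1=H_2$ a.e. in $(0,T)\times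 G$. -/

import Mathlib

open MeasureTheory Set
open scoped ContDiff ENNReal

noncomputable section

namespace ImageFilter

/-- `φ` is a test function on `U`: smooth, with compact support contained in `U`. -/
def IsTestFunction {X : Type*} [NormedAddCommGroup X] [NormedSpace ℝ X]
    (U : Set X) (φ : X → ℝ) : Prop :=
  ContDiff ℝ ∞ φ ∧ HasCompactSupport φ ∧ tsupport φ ⊆ U

/-- `g` is the weak (distributional) derivative of `f` on `U` in the direction `v`. -/
def IsWeakPartial {X : Type*} [NormedAddCommGroup X] [NormedSpace ℝ X] [MeasureSpace X]
    {Y : Type*} [NormedAddCommGroup Y] [NormedSpace ℝ Y]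
    (U : Set X) (v : X) (f g : X → Y) : Prop :=
  LocallyIntegrableOn f U ∧ LocallyIntegrableOn g U ∧
    ∀ φ : X → ℝ, IsTestFunction U φ →
      ∫ x in U, (fderiv ℝ φ x v) • f x = - ∫ x in U, φ x • g x

/-- The Euclidean space `ℝ^d` containing the spatial domain. -/
abbrev Space (d : ℕ) : Type := EuclideanSpace ℝ (Fin d)

/-- The color space `ℝ^k`. -/
abbrev Color (k : ℕ) : Type := EuclideanSpace ℝ (Fin k)

/-- The space `ℝ^{k × d}` with the Frobenius inner product. -/
abbrev Mat (k d : ℕ) : Type := EuclideanSpace ℝ (Fin k × Fin d)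

/-- The space `S(ℝ^{k × d})` of symmetric fourth-order tensors, `H_{ijIJ} = H_{IJij}`, as a subspace
of `ℝ^{(k × d) × (k × d)}` with the Frobenius inner product. -/
def symTensors (k d : ℕ) :
    Submodule ℝ (EuclideanSpace ℝ ((Fin k × Fin d) × (Fin k × Fin d))) where
  carrier := {H | ∀ p q, H (p, q) = H (q, p)}
  add_mem' := by
    intro a b ha hb p q
    simp [ha p q, hb p q]
  zero_mem' := by
    intro p q
    simp
  smul_mem' := by
    intro c a ha p q
    simp [ha p q]

/-- The type of symmetric fourth-order tensors. -/
abbrev SymTensor (k d : ℕ) : Type := symTensors k d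

/-- The tensor-matrix product `(H D)_{ij} = ∑_{I,J} H_{ijIJ} D_{IJ}`. -/
def SymTensor.apply {k d : ℕ} (H : SymTensor k d) (D : Mat k d) : Mat k d :=
  WithLp.toLp 2 fun p => ∑ q, H.1 (p, q) * D q

/-- The set `S_{≥ κ}(ℝ^{k × d})` of the symmetric tensors `H` with `(H D) : D ≥ κ (D : D)` for
all `D`, that is, with smallest eigenvalue at least `κ`. -/
def symTensorsGe (k d : ℕ) (κ : ℝ) : Set (SymTensor k d) :=
  {H | ∀ D : Mat k d, κ * inner ℝ D D ≤ inner ℝ (H.apply D) D}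

/-- The assumption on the response function: `F` takes values in `S_{≥ 0}`, is weakly
differentiable, and `F` and its weak Jacobian are essentially bounded by some `c > 0`. Such an `F`
agrees almost everywhere with exactly one continuous function; `F` is this representative, so that
`F (∇u)` does not depend on the choice of one. `F' r` is the weak partial derivative with respect
to the `r`-th entry of the matrix. -/
def ResponseAssumption {k d : ℕ} (F : Mat k d → SymTensor k d) : Prop :=
  Continuous F ∧ (∀ D, F D ∈ symTensorsGe k d 0) ∧
    ∃ F' : Fin k × Fin d → Mat k d → SymTensor k d,
      (∀ r, IsWeakPartial univ (EuclideanSpace.single r (1 : ℝ)) F (F' r)) ∧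
      ∃ c : ℝ, 0 < c ∧ (∀ᵐ D, ‖F D‖ ≤ c) ∧ ∀ r, ∀ᵐ D, ‖F' r D‖ ≤ c

/-- `L²(G, ℝ^k)`. -/
abbrev L2 {d : ℕ} (G : Set (Space d)) (k : ℕ) : Type :=
  Lp (Color k) 2 (volume.restrict G)

/-- `L²(G, ℝ^{k × d})`. -/
abbrev L2Mat {d : ℕ} (G : Set (Space d)) (k : ℕ) : Type :=
  Lp (Mat k d) 2 (volume.restrict G)

/-- `L^∞(G, S(ℝ^{k × d}))`. -/
abbrev LinftySym {d : ℕ} (G : Set (Space d)) (k : ℕ) : Type :=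
  Lp (SymTensor k d) ∞ (volume.restrict G)

/-- `D` is the weak gradient (Jacobian) of `u` on `G`: `D_{ij} = ∂_{x_j} u_i`. -/
def IsWeakGradient {d k : ℕ} (G : Set (Space d))
    (u : Space d → Color k) (D : Space d → Mat k d) : Prop :=
  ∀ i j, IsWeakPartial G (EuclideanSpace.single j (1 : ℝ)) (fun x => u x i) (fun x => D x (i, j))

section Helpers

set_option linter.unusedSectionVars false

variable {X : Type*} [NormedAddCommGroup X] [NormedSpace ℝ X] [MeasureSpace X]
  [OpensMeasurableSpace X]

theorem integrable_smul_of_locallyIntegrableOn {U : Set X} {f : X → ℝ}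
    (hf : LocallyIntegrableOn f U) {ψ : X → ℝ} (hψ : Continuous ψ)
    (hc : HasCompactSupport ψ) (hs : tsupport ψ ⊆ U) :
    Integrable (fun x => ψ x • f x) (volume.restrict U) := by
  have hK : IntegrableOn (fun x => ψ x • f x) (tsupport ψ) :=
    (hf.integrableOn_compact_subset hs hc).continuousOn_smul hψ.continuousOn hc
  have h2 : Integrable (fun x => ψ x • f x) := by
    refine (integrableOn_iff_integrable_of_support_subset ?_).1 hK
    intro x hx
    apply subset_tsupport ψ
    intro h0
    simp [h0] at hx
  exact h2.restrict

theorem IsTestFunction.integrable_smul {U : Set X} {f : X → ℝ}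
    (hf : LocallyIntegrableOn f U) {φ : X → ℝ} (hφ : IsTestFunction U φ) :
    Integrable (fun x => φ x • f x) (volume.restrict U) :=
  integrable_smul_of_locallyIntegrableOn hf hφ.1.continuous hφ.2.1 hφ.2.2

theorem IsTestFunction.integrable_fderiv_smul {U : Set X} {f : X → ℝ}
    (hf : LocallyIntegrableOn f U) {φ : X → ℝ} (hφ : IsTestFunction U φ) (v : X) :
    Integrable (fun x => fderiv ℝ φ x v • f x) (volume.restrict U) := by
  have hcont : Continuous fun x => fderiv ℝ φ x v :=
    (hφ.1.continuous_fderiv (by simp)).clm_apply continuous_const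
  have hsub : tsupport (fun x => fderiv ℝ φ x v) ⊆ tsupport φ := by
    refine closure_minimal ?_ (isClosed_tsupport φ)
    intro x hx
    apply support_fderiv_subset ℝ
    intro h0
    simp [h0] at hx
  exact integrable_smul_of_locallyIntegrableOn hf hcont
    (hφ.2.1.of_isClosed_subset (isClosed_tsupport _) hsub) (hsub.trans hφ.2.2)

theorem IsWeakPartial.congr {U : Set X} {v : X} {f g f₁ g₁ : X → ℝ}
    (h : IsWeakPartial U v f g) (hf : f =ᵐ[volume.restrict U] f₁)
    (hg : g =ᵐ[volume.restrict U] g₁) (hf₁ : LocallyIntegrableOn f₁ U)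
    (hg₁ : LocallyIntegrableOn g₁ U) : IsWeakPartial U v f₁ g₁ := by
  refine ⟨hf₁, hg₁, fun φ hφ => ?_⟩
  have e1 : ∫ x in U, fderiv ℝ φ x v • f₁ x = ∫ x in U, fderiv ℝ φ x v • f x :=
    integral_congr_ae (by filter_upwards [hf] with x hx; rw [hx])
  have e2 : ∫ x in U, φ x • g₁ x = ∫ x in U, φ x • g x :=
    integral_congr_ae (by filter_upwards [hg] with x hx; rw [hx])
  rw [e1, e2, h.2.2 φ hφ]

theorem IsWeakPartial.add {U : Set X} {v : X} {f₁ g₁ f₂ g₂ : X → ℝ}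
    (h₁ : IsWeakPartial U v f₁ g₁) (h₂ : IsWeakPartial U v f₂ g₂) :
    IsWeakPartial U v (f₁ + f₂) (g₁ + g₂) := by
  refine ⟨h₁.1.add h₂.1, h₁.2.1.add h₂.2.1, fun φ hφ => ?_⟩
  simp only [Pi.add_apply, smul_add]
  rw [integral_add (hφ.integrable_fderiv_smul h₁.1 v) (hφ.integrable_fderiv_smul h₂.1 v),
    integral_add (hφ.integrable_smul h₁.2.1) (hφ.integrable_smul h₂.2.1),
    h₁.2.2 φ hφ, h₂.2.2 φ hφ]
  ring

theorem IsWeakPartial.const_smul {U : Set X} {v : X} {f g : X → ℝ} (c : ℝ)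
    (h : IsWeakPartial U v f g) : IsWeakPartial U v (c • f) (c • g) := by
  refine ⟨h.1.smul c, h.2.1.smul c, fun φ hφ => ?_⟩
  simp only [Pi.smul_apply, smul_comm _ c]
  rw [integral_smul, integral_smul, h.2.2 φ hφ, smul_neg]

theorem locallyIntegrableOn_coord {d : ℕ} {ι : Type*} [Fintype ι] {G : Set (Space d)}
    (f : Lp (EuclideanSpace ℝ ι) 2 (volume.restrict G)) (i : ι) :
    LocallyIntegrableOn (fun x => f x i) G := by
  have h1 : MemLp (fun x => f x i) 2 (volume.restrict G) :=
    (EuclideanSpace.proj (𝕜 := ℝ) i : EuclideanSpace ℝ ι →L[ℝ] ℝ).comp_memLp' (Lp.memLp f)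
  exact locallyIntegrableOn_of_locallyIntegrable_restrict
    (h1.locallyIntegrable one_le_two)

end Helpers

/-- The Sobolev space `H¹(G, ℝ^k)`, realized as the space of the pairs `(u, ∇u)` in
`L²(G, ℝ^k) × L²(G, ℝ^{k × d})`, with `‖u‖² + ‖∇u‖²` as the square of the norm. -/
def sobolevH1 {d : ℕ} (G : Set (Space d)) (k : ℕ) :
    Submodule ℝ (WithLp 2 (L2 G k × L2Mat G k)) where
  carrier := {p | IsWeakGradient G p.fst p.snd}
  add_mem' := by
    intro a b ha hb i j
    refine ((ha i j).add (hb i j)).congr ?_ ?_ (locallyIntegrableOn_coord _ i)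
      (locallyIntegrableOn_coord _ (i, j))
    · filter_upwards [Lp.coeFn_add a.fst b.fst] with x hx
      exact (congrArg (fun y : Color k => y i) hx).symm
    · filter_upwards [Lp.coeFn_add a.snd b.snd] with x hx
      exact (congrArg (fun y : Mat k d => y (i, j)) hx).symm
  zero_mem' := by
    intro i j
    refine ⟨locallyIntegrableOn_coord _ i, locallyIntegrableOn_coord _ (i, j), fun φ _ => ?_⟩
    have e1 : ∫ x in G, fderiv ℝ φ x (EuclideanSpace.single j (1 : ℝ)) •
        ((0 : WithLp 2 (L2 G k × L2Mat G k)).fst x i) = 0 := by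
      apply integral_eq_zero_of_ae
      filter_upwards [Lp.coeFn_zero (Color k) 2 (volume.restrict G)] with x hx
      have hx' : ((0 : WithLp 2 (L2 G k × L2Mat G k)).fst : Space d → Color k) x = 0 := hx
      simp only [hx', PiLp.zero_apply, smul_zero, Pi.zero_apply]
    have e2 : ∫ x in G, φ x • ((0 : WithLp 2 (L2 G k × L2Mat G k)).snd x (i, j)) = 0 := by
      apply integral_eq_zero_of_ae
      filter_upwards [Lp.coeFn_zero (Mat k d) 2 (volume.restrict G)] with x hx
      have hx' : ((0 : WithLp 2 (L2 G k × L2Mat G k)).snd : Space d → Mat k d) x = 0 := hx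
      simp only [hx', PiLp.zero_apply, smul_zero, Pi.zero_apply]
    rw [e1, e2, neg_zero]
  smul_mem' := by
    intro c a ha i j
    refine ((ha i j).const_smul c).congr ?_ ?_ (locallyIntegrableOn_coord _ i)
      (locallyIntegrableOn_coord _ (i, j))
    · filter_upwards [Lp.coeFn_smul c a.fst] with x hx
      exact (congrArg (fun y : Color k => y i) hx).symm
    · filter_upwards [Lp.coeFn_smul c a.snd] with x hx
      exact (congrArg (fun y : Mat k d => y (i, j)) hx).symm

/-- The space `H = L²(G, ℝ^k)/{1}` of the `u` in `L²(G, ℝ^k)` with `∫_G u = 0` (integrability is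
automatic on a bounded `G`). -/
def spaceH {d : ℕ} (G : Set (Space d)) (k : ℕ) : Submodule ℝ (L2 G k) where
  carrier := {u | Integrable u (volume.restrict G) ∧ ∫ x in G, u x = 0}
  add_mem' := by
    intro a b ha hb
    refine ⟨(ha.1.add hb.1).congr (Lp.coeFn_add a b).symm, ?_⟩
    rw [integral_congr_ae (Lp.coeFn_add a b)]
    simp only [Pi.add_apply]
    rw [integral_add ha.1 hb.1, ha.2, hb.2, add_zero]
  zero_mem' := by
    have h0 := Lp.coeFn_zero (Color k) 2 ((volume : Measure (Space d)).restrict G)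
    refine ⟨(integrable_zero _ _ _).congr h0.symm, ?_⟩
    rw [integral_congr_ae h0]
    simp
  smul_mem' := by
    intro c a ha
    refine ⟨(ha.1.smul c).congr (Lp.coeFn_smul c a).symm, ?_⟩
    rw [integral_congr_ae (Lp.coeFn_smul c a)]
    simp only [Pi.smul_apply]
    rw [integral_smul, ha.2, smul_zero]

/-- The space `V = H¹(G, ℝ^k) ∩ H`, with the norm of `H¹`. -/
def spaceV {d : ℕ} (G : Set (Space d)) (k : ℕ) : Submodule ℝ (WithLp 2 (L2 G k × L2Mat G k)) :=
  sobolevH1 G k ⊓ (spaceH G k).comap (WithLp.fstL 2 ℝ (L2 G k) (L2Mat G k)).toLinearMap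

variable {d k : ℕ} {G : Set (Space d)}

/-- The embedding of `V` into `L²(G, ℝ^k)` (with values in `H`). -/
def toL2 (u : spaceV G k) : L2 G k := u.1.fst

/-- The weak gradient of an element of `V`. -/
def grad (u : spaceV G k) : L2Mat G k := u.1.snd

/-- The embedding of `V` into `V'` of the Gelfand triple: `u` acts on `v` as `∫_G u · v`. -/
def toDual (u : spaceV G k) : StrongDual ℝ (spaceV G k) :=
  (innerSL ℝ (toL2 u)).comp
    ((WithLp.fstL 2 ℝ (L2 G k) (L2Mat G k)).comp (spaceV G k).subtypeL)

/-- The bilinear form `a(u, v; H) = ∫_G (H ∇u) : ∇v`, that is, `⟨A(H) u, v⟩`. -/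
def aForm (H : LinftySym G k) (u v : spaceV G k) : ℝ :=
  ∫ x in G, inner ℝ ((H x).apply (grad u x)) (grad v x)

/-- Lebesgue measure on the time interval `(0, T)`. -/
def timeMeasure (T : ℝ) : Measure ℝ := volume.restrict (Ioo 0 T)

/-- `g` is the weak derivative on `(0, T)` of the Banach space valued function `f`. -/
def HasWeakTimeDeriv {Y : Type*} [NormedAddCommGroup Y] [NormedSpace ℝ Y]
    (T : ℝ) (f g : ℝ → Y) : Prop :=
  ∀ φ : ℝ → ℝ, IsTestFunction (Ioo 0 T) φ →
    ∫ t, deriv φ t • f t ∂(timeMeasure T) = - ∫ t, φ t • g t ∂(timeMeasure T)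

/-- `f(0) = y` in the sense of an embedding into `C([0, T], Y)`: the continuous representative
of `f` on `[0, T]` takes the value `y` at `0`. -/
def HasInitialValue {Y : Type*} [NormedAddCommGroup Y] (T : ℝ) (f : ℝ → Y) (y : Y) : Prop :=
  ∃ g : ℝ → Y, ContinuousOn g (Icc 0 T) ∧ g =ᵐ[timeMeasure T] f ∧ g 0 = y

/-- `(u, H)` is a weak solution on `[0, T]` of
`∂ₜ u + A(H) u = 0` in `L²(0, T; V')`, `τ ∂ₜ H + H - F(∇u) = 0` in `L²(0, T; L^∞(G, S))`,
`u(0) = u₀` in `H`, `H(0) = H₀` in `L^∞(G, S)`. -/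
def IsWeakSolution (T τ : ℝ) (F : Mat k d → SymTensor k d) (u₀ : spaceH G k) (H₀ : LinftySym G k)
    (u : ℝ → spaceV G k) (H : ℝ → LinftySym G k) : Prop :=
  -- `H ∈ S_{≥ κ}` almost everywhere in `(0, T) × G` for some `κ > 0`
  (∃ κ : ℝ, 0 < κ ∧
    ∀ᵐ t ∂(timeMeasure T), ∀ᵐ x ∂(volume.restrict G), H t x ∈ symTensorsGe k d κ) ∧
  -- `u ∈ H¹(0, T; V') ∩ L²(0, T; V)`, and the first equation
  MemLp u 2 (timeMeasure T) ∧
  (∃ u' : ℝ → StrongDual ℝ (spaceV G k),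
    MemLp u' 2 (timeMeasure T) ∧ HasWeakTimeDeriv T (fun t => toDual (u t)) u' ∧
    ∀ᵐ t ∂(timeMeasure T), ∀ v, u' t v + aForm (H t) (u t) v = 0) ∧
  -- `H ∈ H¹(0, T; L^∞(G, S))`, and the second equation
  MemLp H 2 (timeMeasure T) ∧
  (∃ H' : ℝ → LinftySym G k,
    MemLp H' 2 (timeMeasure T) ∧ HasWeakTimeDeriv T H H' ∧
    ∀ᵐ t ∂(timeMeasure T), ∀ᵐ x ∂(volume.restrict G),
      τ • H' t x + H t x - F (grad (u t) x) = 0) ∧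
  -- the initial conditions
  HasInitialValue T (fun t => toL2 (u t)) u₀.1 ∧
  HasInitialValue T H H₀

/-- `∇u ∈ L^∞((0, T) × G, ℝ^{k × d})`. -/
def HasBoundedGradient (T : ℝ) (u : ℝ → spaceV G k) : Prop :=
  ∃ M : ℝ, ∀ᵐ t ∂(timeMeasure T), ∀ᵐ x ∂(volume.restrict G), ‖grad (u t) x‖ ≤ M

end ImageFilter

end

/-!
Let `w = u₁ - u₂` and `h = H₁ - H₂`. Subtracting the two diffusion equations and testing with `w`
gives `½ d/dt ‖w‖² = -∫ (H₁ ∇w) : ∇w - ∫ (h ∇u₂) : ∇w`. The uniform ellipticity of `H₁`, the bound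
`M` for `∇u₂` and Young's inequality turn this into
`‖w(t)‖² + κ ∫₀ᵗ ‖∇w‖² ≤ M² / κ ∫₀ᵗ ‖h‖²`, with all spatial norms taken in `L²(G)`. In the difference
of the two relaxation equations `F` enters only through its Lipschitz constant `L`, and testing with
`h` gives `‖h(t)‖² ≤ L² / (2τ) ∫₀ᵗ ‖∇w‖²`. Together, `‖h(t)‖²` is bounded by a constant times
`∫₀ᵗ ‖h‖²`, so `h = 0` by Grönwall's inequality, and then `w = 0`.

Three ingredients make this rigorous.

* `HasWeakTimeDeriv.sub_eq_integral`: the continuous representative of a function with an integrable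
  weak time derivative is a primitive of that derivative.
* `norm_sq_le_integral_apply`: the energy inequality `‖w(t)‖² ≤ 2 ∫₀ᵗ ⟨w', w⟩` in a Gelfand triple,
  where `w'` takes values only in the dual of `V`. Only this inequality between the two sides is
  needed, so the convexity of the square norm can replace the product rule: it bounds the difference
  quotients of `‖w‖²` by pairings of `w` with Steklov averages of `w'`, and these converge because
  translations are continuous in `L²`.
* `norm_sub_le_of_isWeakPartial`: a continuous function with bounded weak partial derivatives is
  Lipschitz continuous.

The coupling of the two estimates is carried out in `ae_eq_of_coercive_of_relaxation`, for abstract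
spaces. The exceptional set in `(0, T) × G` is a null set of times: at every other time the solutions
are equal as elements of the Lebesgue spaces on `G`, hence have the same representatives.
-/

namespace ImageFilter

open Filter Topology

/-! ### Functions with a weak time derivative -/

theorem continuous_deriv_smoothTransition : Continuous (deriv Real.smoothTransition) :=
  (Real.smoothTransition.contDiff (n := 1)).continuous_deriv le_rfl

theorem deriv_smoothTransition_of_notMem {x : ℝ} (hx : x ∉ Icc (0 : ℝ) 1) :
    deriv Real.smoothTransition x = 0 := by
  rcases not_and_or.1 hx with h | h
  · have : Real.smoothTransition =ᶠ[𝓝 x] fun _ => (0 : ℝ) := by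
      filter_upwards [Iio_mem_nhds (not_le.1 h)] with y hy
      exact Real.smoothTransition.zero_of_nonpos (le_of_lt hy)
    rw [this.deriv_eq, deriv_const]
  · have : Real.smoothTransition =ᶠ[𝓝 x] fun _ => (1 : ℝ) := by
      filter_upwards [Ioi_mem_nhds (not_le.1 h)] with y hy
      exact Real.smoothTransition.one_of_one_le (le_of_lt hy)
    rw [this.deriv_eq, deriv_const]

theorem integrable_deriv_smoothTransition : Integrable (deriv Real.smoothTransition) :=
  continuous_deriv_smoothTransition.integrable_of_hasCompactSupport
    (HasCompactSupport.intro isCompact_Icc fun _ => deriv_smoothTransition_of_notMem)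

theorem integral_deriv_smoothTransition : ∫ x, deriv Real.smoothTransition x = 1 := by
  have h1 : ∫ x, deriv Real.smoothTransition x =
      ∫ x in Icc (0 : ℝ) 1, deriv Real.smoothTransition x :=
    (setIntegral_eq_integral_of_forall_compl_eq_zero
      fun x hx => deriv_smoothTransition_of_notMem hx).symm
  rw [h1, integral_Icc_eq_integral_Ioc, ← intervalIntegral.integral_of_le zero_le_one,
    intervalIntegral.integral_deriv_eq_sub]
  · simp
  · exact fun x _ =>
      (Real.smoothTransition.contDiff (n := 1)).differentiable one_ne_zero x
  · exact continuous_deriv_smoothTransition.intervalIntegrable _ _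

/-- The derivatives of the steps `x ↦ smoothTransition (n (x - s))` form an approximate identity at
`s`. -/
theorem tendsto_integral_deriv_smoothTransition_smul {Y : Type*} [NormedAddCommGroup Y]
    [NormedSpace ℝ Y] [CompleteSpace Y] {g : ℝ → Y} (hg : Continuous g) {C : ℝ}
    (hC : ∀ x, ‖g x‖ ≤ C) (s : ℝ) :
    Tendsto (fun n : ℕ => ∫ x, ((n : ℝ) * deriv Real.smoothTransition (n * (x - s))) • g x)
      atTop (𝓝 (g s)) := by
  have key : Tendsto (fun n : ℕ => ∫ y, deriv Real.smoothTransition y • g (s + y / n)) atTop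
      (𝓝 (∫ y, deriv Real.smoothTransition y • g s)) := by
    refine tendsto_integral_of_dominated_convergence
      (fun y => ‖deriv Real.smoothTransition y‖ * C) ?_ ?_ ?_ ?_
    · intro n
      exact (continuous_deriv_smoothTransition.smul
        (hg.comp (by fun_prop))).aestronglyMeasurable
    · exact integrable_deriv_smoothTransition.norm.mul_const _
    · intro n
      refine Eventually.of_forall fun y => ?_
      rw [norm_smul]
      exact mul_le_mul_of_nonneg_left (hC _) (norm_nonneg _)
    · refine Eventually.of_forall fun y => Tendsto.const_smul ?_ _
      have h1 : Tendsto (fun n : ℕ => s + y / (n : ℝ)) atTop (𝓝 (s + 0)) :=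
        tendsto_const_nhds.add (tendsto_const_div_atTop_nhds_zero_nat y)
      rw [add_zero] at h1
      exact (hg.tendsto s).comp h1
  rw [integral_smul_const, integral_deriv_smoothTransition, one_smul] at key
  refine key.congr' ?_
  filter_upwards [eventually_gt_atTop 0] with n hn
  have hn' : (0 : ℝ) < n := by exact_mod_cast hn
  have e1 := Measure.integral_comp_mul_left
    (fun y => deriv Real.smoothTransition y • g (s + y / n)) (n : ℝ)
  have e2 := integral_sub_right_eq_self (μ := volume)
    (fun x => deriv Real.smoothTransition (n * x) • g (s + n * x / n)) s
  rw [abs_of_pos (inv_pos.2 hn')] at e1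
  rw [← e2] at e1
  rw [eq_inv_smul_iff₀ hn'.ne', ← integral_smul] at e1
  rw [← e1]
  refine integral_congr_ae (Eventually.of_forall fun x => ?_)
  have : s + (n : ℝ) * (x - s) / n = x := by field_simp; ring
  simp only [this, smul_smul]

theorem hasDerivAt_smoothTransition_mul_sub (n s x : ℝ) :
    HasDerivAt (fun x => Real.smoothTransition (n * (x - s)))
      (n * deriv Real.smoothTransition (n * (x - s))) x := by
  have h1 : HasDerivAt (fun x : ℝ => n * (x - s)) (n * 1) x :=
    ((hasDerivAt_id x).sub_const s).const_mul n
  have h2 := ((Real.smoothTransition.contDiff (n := 1)).differentiable one_ne_zero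
    (n * (x - s))).hasDerivAt
  have := h2.comp x h1
  convert! this using 1
  ring

theorem isTestFunction_smoothTransition_sub {T s t : ℝ} {n : ℕ} (hs : 0 < s) (hst : s ≤ t)
    (hn : 0 < n) (ht : t + 1 / n < T) :
    IsTestFunction (Ioo 0 T)
      (fun x => Real.smoothTransition (n * (x - s)) - Real.smoothTransition (n * (x - t))) := by
  have hn' : (0 : ℝ) < n := by exact_mod_cast hn
  have hz : ∀ x, x ∉ Icc s (t + 1 / n) →
      Real.smoothTransition (n * (x - s)) - Real.smoothTransition (n * (x - t)) = 0 := by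
    intro x hx
    rcases not_and_or.1 hx with h | h
    · have h := not_le.1 h
      rw [Real.smoothTransition.zero_of_nonpos, Real.smoothTransition.zero_of_nonpos, sub_zero]
      · exact mul_nonpos_of_nonneg_of_nonpos hn'.le (by linarith)
      · exact mul_nonpos_of_nonneg_of_nonpos hn'.le (by linarith)
    · have h := not_le.1 h
      have h2 : 1 ≤ (n : ℝ) * (x - t) := by
        have : 1 / (n : ℝ) ≤ x - t := by linarith
        rw [div_le_iff₀ hn'] at this
        linarith
      rw [Real.smoothTransition.one_of_one_le, Real.smoothTransition.one_of_one_le h2, sub_self]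
      nlinarith
  refine ⟨?_, HasCompactSupport.intro isCompact_Icc hz, ?_⟩
  · exact ((Real.smoothTransition.contDiff (n := ⊤)).comp (by fun_prop)).sub
      ((Real.smoothTransition.contDiff (n := ⊤)).comp (by fun_prop))
  · refine (closure_minimal (fun x hx => ?_) isClosed_Icc).trans
      (fun x (hx : x ∈ Icc s (t + 1 / n)) => ⟨hs.trans_le hx.1, hx.2.trans_lt ht⟩)
    by_contra h
    exact hx (hz x h)

/-- The fundamental theorem of calculus for a bounded continuous `f`: the weak derivative is tested
with smooth approximations of the indicator function of `(s, t]`. -/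
theorem HasWeakTimeDeriv.sub_eq_integral_of_continuous {Y : Type*} [NormedAddCommGroup Y]
    [NormedSpace ℝ Y] [CompleteSpace Y] {T : ℝ} {f f' : ℝ → Y} (h : HasWeakTimeDeriv T f f')
    (hf' : Integrable f' (timeMeasure T)) (hf : Continuous f) {C : ℝ} (hC : ∀ x, ‖f x‖ ≤ C)
    {s t : ℝ} (hs : 0 < s) (hst : s ≤ t) (ht : t < T) :
    f t - f s = ∫ r in s..t, f' r := by
  set φ : ℕ → ℝ → ℝ := fun n x =>
    Real.smoothTransition (n * (x - s)) - Real.smoothTransition (n * (x - t)) with hφ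
  have hev : ∀ᶠ n : ℕ in atTop, IsTestFunction (Ioo 0 T) (φ n) := by
    have h1 : Tendsto (fun n : ℕ => t + 1 / (n : ℝ)) atTop (𝓝 (t + 0)) :=
      tendsto_const_nhds.add (tendsto_const_div_atTop_nhds_zero_nat 1)
    rw [add_zero] at h1
    filter_upwards [h1.eventually (gt_mem_nhds ht), eventually_gt_atTop 0] with n h2 h3
    exact isTestFunction_smoothTransition_sub hs hst h3 h2
  have hderiv : ∀ n : ℕ, deriv (φ n) = fun x =>
      n * deriv Real.smoothTransition (n * (x - s)) -
        n * deriv Real.smoothTransition (n * (x - t)) := fun n => funext fun x =>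
    ((hasDerivAt_smoothTransition_mul_sub n s x).sub
      (hasDerivAt_smoothTransition_mul_sub n t x)).deriv
  have hint : ∀ (n : ℕ) (a : ℝ), 0 < n → Integrable
      (fun x => ((n : ℝ) * deriv Real.smoothTransition (n * (x - a))) • f x) := by
    intro n a hn
    have hn' : (n : ℝ) ≠ 0 := by exact_mod_cast hn.ne'
    have h1 : Integrable (fun x => (n : ℝ) * deriv Real.smoothTransition (n * (x - a))) :=
      ((integrable_deriv_smoothTransition.comp_mul_left' hn').comp_sub_right a).const_mul _
    exact h1.smul_bdd C hf.aestronglyMeasurable (Eventually.of_forall hC)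
  have lim1 : Tendsto (fun n : ℕ => ∫ x, deriv (φ n) x • f x ∂(timeMeasure T)) atTop
      (𝓝 (f s - f t)) := by
    refine ((tendsto_integral_deriv_smoothTransition_smul hf hC s).sub
      (tendsto_integral_deriv_smoothTransition_smul hf hC t)).congr' ?_
    filter_upwards [hev, eventually_gt_atTop 0] with n hn hn0
    rw [← integral_sub (hint n s hn0) (hint n t hn0), timeMeasure,
      setIntegral_eq_integral_of_forall_compl_eq_zero]
    · refine integral_congr_ae (Eventually.of_forall fun x => ?_)
      simp only [hderiv, sub_smul]
    · intro x hx
      have h0 : deriv (φ n) x = 0 := by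
        by_contra h0
        exact hx (hn.2.2 (support_deriv_subset (f := φ n) h0))
      rw [h0, zero_smul]
  have lim2 : Tendsto (fun n : ℕ => ∫ x, φ n x • f' x ∂(timeMeasure T)) atTop
      (𝓝 (∫ x, (Ioc s t).indicator f' x ∂(timeMeasure T))) := by
    refine tendsto_integral_of_dominated_convergence (fun x => ‖f' x‖) ?_ hf'.norm ?_ ?_
    · intro n
      have : Continuous (φ n) :=
        (Real.smoothTransition.continuous.comp (by fun_prop)).sub
          (Real.smoothTransition.continuous.comp (by fun_prop))
      exact this.aestronglyMeasurable.smul hf'.1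
    · intro n
      refine Eventually.of_forall fun x => ?_
      rw [norm_smul]
      refine mul_le_of_le_one_left (norm_nonneg _) ?_
      rw [Real.norm_eq_abs, abs_le]
      have := Real.smoothTransition.nonneg (n * (x - s))
      have := Real.smoothTransition.nonneg (n * (x - t))
      have := Real.smoothTransition.le_one (n * (x - s))
      have := Real.smoothTransition.le_one (n * (x - t))
      constructor <;> simp only [hφ] <;> linarith
    · refine Eventually.of_forall fun x => ?_
      have hstep : ∀ a : ℝ, Tendsto (fun n : ℕ => Real.smoothTransition (n * (x - a))) atTop
          (𝓝 (if a < x then 1 else 0)) := by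
        intro a
        split_ifs with hax
        · refine tendsto_const_nhds.congr' ?_
          have h1 : Tendsto (fun n : ℕ => (n : ℝ) * (x - a)) atTop atTop :=
            tendsto_natCast_atTop_atTop.atTop_mul_const (sub_pos.2 hax)
          filter_upwards [h1.eventually_ge_atTop 1] with n hn
          exact (Real.smoothTransition.one_of_one_le hn).symm
        · refine tendsto_const_nhds.congr fun n => ?_
          exact (Real.smoothTransition.zero_of_nonpos
            (mul_nonpos_of_nonneg_of_nonpos n.cast_nonneg (by linarith))).symm
      have h2 := ((hstep s).sub (hstep t)).smul_const (f' x)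
      convert h2 using 2
      by_cases hx : x ∈ Ioc s t
      · rw [indicator_of_mem hx, if_pos hx.1, if_neg (not_lt.2 hx.2), sub_zero, one_smul]
      · rw [indicator_of_notMem hx]
        by_cases hsx : s < x
        · have : t < x := by
            by_contra hxt
            exact hx ⟨hsx, not_lt.1 hxt⟩
          rw [if_pos hsx, if_pos this, sub_self, zero_smul]
        · rw [if_neg hsx, if_neg (fun htx => hsx (hst.trans_lt htx)), sub_self, zero_smul]
  have heq := tendsto_nhds_unique (lim1.congr' (by
    filter_upwards [hev] with n hn
    exact h (φ n) hn)) lim2.neg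
  have hI : ∫ x, (Ioc s t).indicator f' x ∂(timeMeasure T) = ∫ r in s..t, f' r := by
    have hsub : Ioc s t ⊆ Ioo 0 T := fun x hx => ⟨hs.trans hx.1, hx.2.trans_lt ht⟩
    rw [integral_indicator measurableSet_Ioc, timeMeasure,
      Measure.restrict_restrict measurableSet_Ioc, intervalIntegral.integral_of_le hst,
      inter_eq_left.2 hsub]
  rw [← hI, ← neg_sub, heq, neg_neg]

theorem intervalIntegrable_of_timeMeasure {Y : Type*} [NormedAddCommGroup Y] {T : ℝ} {f : ℝ → Y}
    (hf : Integrable f (timeMeasure T)) {s t : ℝ} (hs : s ∈ Icc 0 T) (ht : t ∈ Icc 0 T) :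
    IntervalIntegrable f volume s t := by
  have hT : 0 ≤ T := hs.1.trans hs.2
  have h1 : IntervalIntegrable f volume 0 T := by
    rw [intervalIntegrable_iff_integrableOn_Ioo_of_le hT]
    exact hf
  exact h1.mono_set (by rw [uIcc_of_le hT]; exact uIcc_subset_Icc hs ht)

/-- The fundamental theorem of calculus for the continuous representative `g` of a function `f` with
an integrable weak derivative. -/
theorem HasWeakTimeDeriv.sub_eq_integral {Y : Type*} [NormedAddCommGroup Y]
    [NormedSpace ℝ Y] [CompleteSpace Y] {T : ℝ} {f f' g : ℝ → Y} (h : HasWeakTimeDeriv T f f')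
    (hf' : Integrable f' (timeMeasure T)) (hT : 0 < T) (hg : ContinuousOn g (Icc 0 T))
    (hgf : g =ᵐ[timeMeasure T] f) {t : ℝ} (ht : t ∈ Icc 0 T) :
    g t - g 0 = ∫ r in 0..t, f' r := by
  set e : ℝ → Y := IccExtend hT.le ((Icc 0 T).domRestrict g) with he
  have he_cont : Continuous e := (continuousOn_iff_continuous_domRestrict.1 hg).Icc_extend'
  have he_eq : ∀ x ∈ Icc 0 T, e x = g x := fun x hx => IccExtend_of_mem _ _ hx
  obtain ⟨C, hC⟩ := (isCompact_Icc (a := (0 : ℝ)) (b := T)).exists_bound_of_continuousOn hg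
  have hCe : ∀ x, ‖e x‖ ≤ C := fun x => hC _ (projIcc 0 T hT.le x).2
  have hwe : HasWeakTimeDeriv T e f' := by
    intro φ hφ
    rw [← h φ hφ]
    refine integral_congr_ae ?_
    filter_upwards [hgf, ae_restrict_mem measurableSet_Ioo] with x hx hx'
    rw [he_eq x (Ioo_subset_Icc_self hx'), hx]
  have hprim : ContinuousOn (fun t => ∫ r in 0..t, f' r) (Icc 0 T) := by
    have := intervalIntegral.continuousOn_primitive_interval (μ := volume) (f := f') (a := 0)
      (b := T) (by
        rw [uIcc_of_le hT.le, integrableOn_Icc_iff_integrableOn_Ioo]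
        exact hf')
    rwa [uIcc_of_le hT.le] at this
  -- The function `g - ∫ f'` is constant on the open interval, hence on its closure.
  have hconst : ∀ x ∈ Ioo 0 T,
      e x - ∫ r in 0..x, f' r = e (T / 2) - ∫ r in 0..(T / 2), f' r := by
    have hle : ∀ a b : ℝ, 0 < a → a ≤ b → b < T →
        e a - ∫ r in 0..a, f' r = e b - ∫ r in 0..b, f' r := by
      intro a b ha hab hb
      have h1 := hwe.sub_eq_integral_of_continuous hf' he_cont hCe ha hab hb
      have h2 := intervalIntegral.integral_add_adjacent_intervals (μ := volume)
        (intervalIntegrable_of_timeMeasure hf' (s := 0) (t := a) ⟨le_rfl, hT.le⟩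
          ⟨ha.le, hab.trans hb.le⟩)
        (intervalIntegrable_of_timeMeasure hf' (s := a) (t := b) ⟨ha.le, hab.trans hb.le⟩
          ⟨ha.le.trans hab, hb.le⟩)
      rw [← h2, ← h1]
      abel
    intro x hx
    rcases le_total x (T / 2) with hx2 | hx2
    · exact hle _ _ hx.1 hx2 (by linarith)
    · exact (hle _ _ (by linarith) hx2 hx.2).symm
  have hcont : ContinuousOn (fun x => e x - ∫ r in 0..x, f' r) (Icc 0 T) :=
    he_cont.continuousOn.sub hprim
  have hall : EqOn (fun x => e x - ∫ r in 0..x, f' r)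
      (fun _ => e (T / 2) - ∫ r in 0..(T / 2), f' r) (Icc 0 T) := by
    refine EqOn.of_subset_closure hconst hcont continuousOn_const Ioo_subset_Icc_self ?_
    rw [closure_Ioo hT.ne]
  have h0 := hall ⟨le_rfl, hT.le⟩
  have h1 := hall ht
  simp only [intervalIntegral.integral_same, sub_zero] at h0 h1
  rw [← h0] at h1
  rw [← he_eq t ht, ← he_eq 0 ⟨le_rfl, hT.le⟩, ← h1]
  abel

/-! ### The energy inequality in a Gelfand triple -/

theorem integral_norm_sq_eq_norm_toLp_sq {X V : Type*} [MeasurableSpace X] {μ : Measure X}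
    [NormedAddCommGroup V] [InnerProductSpace ℝ V] {f : X → V} (hf : MemLp f 2 μ) :
    ∫ x, ‖f x‖ ^ 2 ∂μ = ‖hf.toLp f‖ ^ 2 := by
  rw [← real_inner_self_eq_norm_sq, L2.inner_def]
  refine integral_congr_ae ?_
  filter_upwards [hf.coeFn_toLp] with x hx
  rw [hx, real_inner_self_eq_norm_sq]

theorem norm_sq_eq_integral_norm_sq {X V : Type*} [MeasurableSpace X] {μ : Measure X}
    [NormedAddCommGroup V] [InnerProductSpace ℝ V] (f : Lp V 2 μ) :
    ‖f‖ ^ 2 = ∫ x, ‖f x‖ ^ 2 ∂μ := by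
  rw [integral_norm_sq_eq_norm_toLp_sq (Lp.memLp f), Lp.toLp_coeFn]

/-- Continuity of the translations in `L²(ℝ; V)`. -/
theorem tendsto_integral_norm_translate_sub_sq {V : Type*} [NormedAddCommGroup V]
    [InnerProductSpace ℝ V] {w : ℝ → V} (hw : MemLp w 2) :
    Tendsto (fun a => ∫ r, ‖w (a + r) - w r‖ ^ 2) (𝓝 0) (𝓝 0) := by
  set τ : C(ℝ, C(ℝ, ℝ)) := (ContinuousMap.mk (fun p : ℝ × ℝ => p.1 + p.2) continuous_add).curry
  have hτ : ∀ a, MeasurePreserving (τ a) volume volume := measurePreserving_add_left volume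
  have hcont : Continuous fun a : ℝ =>
      ‖Lp.compMeasurePreserving (τ a) (hτ a) (hw.toLp w) - hw.toLp w‖ ^ 2 :=
    (((continuous_const.compMeasurePreservingLp τ.continuous hτ (by simp)).sub
      continuous_const).norm).pow 2
  have heq : ∀ a, ‖Lp.compMeasurePreserving (τ a) (hτ a) (hw.toLp w) - hw.toLp w‖ ^ 2 =
      ∫ r, ‖w (a + r) - w r‖ ^ 2 := by
    intro a
    have hwa : MemLp (fun r => w (a + r)) 2 := hw.comp_measurePreserving (hτ a)
    have e1 : Lp.compMeasurePreserving (τ a) (hτ a) (hw.toLp w) = hwa.toLp := rfl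
    rw [e1, ← MemLp.toLp_sub hwa hw, ← integral_norm_sq_eq_norm_toLp_sq]
    rfl
  simp only [heq] at hcont
  have h0 := hcont.tendsto 0
  simpa using h0

section

variable {V : Type*} [NormedAddCommGroup V] [InnerProductSpace ℝ V]

theorem abs_apply_le_sq_add_sq (L : StrongDual ℝ V) (v : V) {c : ℝ} (hc : 0 < c) :
    |L v| ≤ c * ‖L‖ ^ 2 + (4 * c)⁻¹ * ‖v‖ ^ 2 := by
  have h1 : |L v| ≤ ‖L‖ * ‖v‖ := L.le_opNorm v
  have h2 : 0 ≤ (4 * c)⁻¹ * (2 * c * ‖L‖ - ‖v‖) ^ 2 := by positivity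
  have h3 : (4 * c)⁻¹ * (2 * c * ‖L‖ - ‖v‖) ^ 2 =
      c * ‖L‖ ^ 2 - ‖L‖ * ‖v‖ + (4 * c)⁻¹ * ‖v‖ ^ 2 := by
    field_simp
    ring
  linarith

theorem integrable_norm_sq {X Y : Type*} [MeasurableSpace X] {μ : Measure X}
    [NormedAddCommGroup Y] {f : X → Y} (hf : MemLp f 2 μ) : Integrable (fun x => ‖f x‖ ^ 2) μ :=
  (memLp_two_iff_integrable_sq_norm hf.1).1 hf

theorem aestronglyMeasurable_apply {X : Type*} [MeasurableSpace X] {μ : Measure X}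
    {W : X → StrongDual ℝ V} {w : X → V} (hW : AEStronglyMeasurable W μ)
    (hw : AEStronglyMeasurable w μ) : AEStronglyMeasurable (fun x => W x (w x)) μ :=
  (isBoundedBilinearMap_apply (𝕜 := ℝ) (E := V) (F := ℝ)).continuous.comp_aestronglyMeasurable
    (hW.prodMk hw)

theorem integrable_apply {X : Type*} [MeasurableSpace X] {μ : Measure X}
    {W : X → StrongDual ℝ V} {w : X → V} (hW : MemLp W 2 μ) (hw : MemLp w 2 μ) :
    Integrable (fun x => W x (w x)) μ := by
  refine (((integrable_norm_sq hW).const_mul 1).add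
    ((integrable_norm_sq hw).const_mul (4 * 1)⁻¹)).mono'
      (aestronglyMeasurable_apply hW.1 hw.1) (Eventually.of_forall fun x => ?_)
  exact abs_apply_le_sq_add_sq _ _ one_pos

/-- The integrability needed for exchanging the two integrals over the Steklov averages. -/
theorem integrable_translate_apply_translate {W : ℝ → StrongDual ℝ V} {w : ℝ → V}
    (hW : MemLp W 2) (hw : MemLp w 2) (h : ℝ) (I J : Set ℝ) (hJ : volume J ≠ ⊤) :
    Integrable (fun p : ℝ × ℝ => W (p.1 + p.2) (w (p.1 + h)))
      ((volume.restrict I).prod (volume.restrict J)) := by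
  have : IsFiniteMeasure (volume.restrict J) := ⟨by simpa using hJ.lt_top⟩
  have hle : (volume.restrict I).prod (volume.restrict J) ≤
      (volume : Measure ℝ).prod (volume.restrict J) :=
    Measure.prod_mono Measure.restrict_le_self le_rfl
  refine Integrable.mono_measure ?_ hle
  have m1 : MeasurePreserving (fun z : ℝ × ℝ => (z.1 + z.2, z.2))
      ((volume : Measure ℝ).prod (volume.restrict J))
      ((volume : Measure ℝ).prod (volume.restrict J)) :=
    measurePreserving_add_prod _ _
  have m2 : MeasurePreserving (fun r : ℝ => r + h) volume volume :=
    measurePreserving_add_right volume h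
  have hwh : MemLp (fun r => w (r + h)) 2 := hw.comp_measurePreserving m2
  have i1 : Integrable (fun p : ℝ × ℝ => ‖W (p.1 + p.2)‖ ^ 2)
      ((volume : Measure ℝ).prod (volume.restrict J)) :=
    m1.integrable_comp_of_integrable ((integrable_norm_sq hW).comp_fst (volume.restrict J))
  have i2 : Integrable (fun p : ℝ × ℝ => ‖w (p.1 + h)‖ ^ 2)
      ((volume : Measure ℝ).prod (volume.restrict J)) :=
    (integrable_norm_sq hwh).comp_fst (volume.restrict J)
  have a1 : AEStronglyMeasurable (fun p : ℝ × ℝ => W (p.1 + p.2))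
      ((volume : Measure ℝ).prod (volume.restrict J)) :=
    (hW.1.comp_fst (ν := volume.restrict J)).comp_measurePreserving m1
  have a2 : AEStronglyMeasurable (fun p : ℝ × ℝ => w (p.1 + h))
      ((volume : Measure ℝ).prod (volume.restrict J)) := hwh.1.comp_fst
  refine ((i1.const_mul 1).add (i2.const_mul (4 * 1)⁻¹)).mono'
    (aestronglyMeasurable_apply a1 a2) (Eventually.of_forall fun x => ?_)
  exact abs_apply_le_sq_add_sq _ _ one_pos

/-- For small shifts, the pairing of `W` with a translate of `w` exceeds the pairing of `W` with `w`
by at most `ε`, uniformly in the shifts: substitution moves the shift `σ` from `W` to `w`, and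
translations are continuous in `L²`. -/
theorem eventually_integral_translate_apply_translate_le {W : ℝ → StrongDual ℝ V} {w : ℝ → V}
    (hW : MemLp W 2) (hw : MemLp w 2) (hW0 : ∀ r ≤ 0, W r = 0) {t : ℝ} {ε : ℝ} (hε : 0 < ε) :
    ∀ᶠ h in 𝓝[>] (0 : ℝ), ∀ σ ∈ Icc 0 h,
      ∫ s in (-h)..t, W (s + σ) (w (s + h)) ≤ (∫ r in 0..t, W r (w r)) + ε := by
  have hint : Integrable fun r => W r (w r) := integrable_apply hW hw
  set A : ℝ := ∫ r, ‖W r‖ ^ 2 with hA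
  have hA0 : 0 ≤ A := integral_nonneg fun r => by positivity
  -- The weight in Young's inequality leaves at most `ε / 4` for the first of its two terms.
  set c : ℝ := ε / (4 * (A + 1)) with hc
  have hc0 : 0 < c := by positivity
  have hcA : c * A ≤ ε / 4 := by
    rw [hc, div_mul_eq_mul_div, div_le_div_iff₀ (by positivity) (by positivity)]
    nlinarith
  have ev1 : ∀ᶠ a in 𝓝 (0 : ℝ), (4 * c)⁻¹ * ∫ r, ‖w (a + r) - w r‖ ^ 2 < ε / 4 := by
    have h1 := (tendsto_integral_norm_translate_sub_sq hw).const_mul (4 * c)⁻¹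
    rw [mul_zero] at h1
    exact h1.eventually (gt_mem_nhds (by positivity))
  have ev2 : ∀ᶠ a in 𝓝 (0 : ℝ),
      ∫ r in 0..(t + a), W r (w r) < (∫ r in 0..t, W r (w r)) + ε / 2 := by
    have h1 : Continuous fun a : ℝ => ∫ r in 0..(t + a), W r (w r) :=
      (hint.continuous_primitive 0).comp (continuous_const.add continuous_id)
    have h2 := h1.tendsto 0
    rw [add_zero] at h2
    exact h2.eventually (gt_mem_nhds (by linarith))
  obtain ⟨δ, hδ, hball⟩ := Metric.eventually_nhds_iff.1 (ev1.and ev2)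
  filter_upwards [Ioo_mem_nhdsGT hδ] with h hh σ hσ
  have hh0 : 0 < h := hh.1
  have b1 := (hball (y := h - σ) (by
    rw [Real.dist_eq, sub_zero, abs_lt]; constructor <;> linarith [hσ.1, hσ.2, hh.2])).1
  have b2 := (hball (y := σ) (by
    rw [Real.dist_eq, sub_zero, abs_lt]; constructor <;> linarith [hσ.1, hσ.2, hh.2])).2
  have hwa : MemLp (fun r => w (h - σ + r)) 2 :=
    hw.comp_measurePreserving (measurePreserving_add_left volume (h - σ))
  have hdiff : MemLp (fun r => w (h - σ + r) - w r) 2 := hwa.sub hw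
  have hinta : Integrable fun r => W r (w (h - σ + r)) := integrable_apply hW hwa
  have hintd : Integrable fun r => W r (w (h - σ + r) - w r) := integrable_apply hW hdiff
  have e1 : ∫ s in (-h)..t, W (s + σ) (w (s + h)) =
      ∫ r in (-h + σ)..(t + σ), W r (w (h - σ + r)) := by
    rw [← intervalIntegral.integral_comp_add_right (fun r => W r (w (h - σ + r))) σ]
    refine intervalIntegral.integral_congr fun s _ => ?_
    rw [show h - σ + (s + σ) = s + h by ring]
  have e2 : ∫ r in (-h + σ)..(t + σ), W r (w (h - σ + r)) =
      ∫ r in 0..(t + σ), W r (w (h - σ + r)) := by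
    rw [← intervalIntegral.integral_add_adjacent_intervals (b := 0) hinta.intervalIntegrable
      hinta.intervalIntegrable]
    have : ∫ r in (-h + σ)..0, W r (w (h - σ + r)) = 0 := by
      refine intervalIntegral.integral_zero_ae (Eventually.of_forall fun r hr => ?_)
      rw [uIoc_of_le (by linarith [hσ.2])] at hr
      rw [hW0 r hr.2]
      rfl
    rw [this, zero_add]
  have e3 : ∫ r in 0..(t + σ), W r (w (h - σ + r)) =
      (∫ r in 0..(t + σ), W r (w r)) + ∫ r in 0..(t + σ), W r (w (h - σ + r) - w r) := by
    rw [← intervalIntegral.integral_add hint.intervalIntegrable hintd.intervalIntegrable]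
    refine intervalIntegral.integral_congr fun s _ => ?_
    simp
  have hyoung : ∫ r in 0..(t + σ), W r (w (h - σ + r) - w r) ≤
      c * A + (4 * c)⁻¹ * ∫ r, ‖w (h - σ + r) - w r‖ ^ 2 := by
    have i1 := (integrable_norm_sq hW).const_mul c
    have i2 := (integrable_norm_sq hdiff).const_mul (4 * c)⁻¹
    rw [hA, ← integral_const_mul, ← integral_const_mul, ← integral_add i1 i2]
    calc ∫ r in 0..(t + σ), W r (w (h - σ + r) - w r)
        ≤ |∫ r in 0..(t + σ), W r (w (h - σ + r) - w r)| := le_abs_self _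
      _ = ‖∫ r in 0..(t + σ), W r (w (h - σ + r) - w r)‖ := (Real.norm_eq_abs _).symm
      _ ≤ ∫ r in uIoc 0 (t + σ), ‖W r (w (h - σ + r) - w r)‖ :=
        intervalIntegral.norm_integral_le_integral_norm_uIoc
      _ ≤ ∫ r, ‖W r (w (h - σ + r) - w r)‖ :=
        setIntegral_le_integral hintd.norm (Eventually.of_forall fun r => norm_nonneg _)
      _ ≤ _ := integral_mono hintd.norm (i1.add i2) fun r => abs_apply_le_sq_add_sq _ _ hc0
  rw [e1, e2, e3]
  linarith

/-- The energy inequality, for functions on the whole line that vanish on the negative half-line.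

By convexity of the square norm, the difference quotients of `‖g‖²` are bounded by twice the pairing
of `w` with the Steklov averages of `W`. Integrated over `(-h, t)`, they leave the mean value of
`‖g‖²` over `(t, t + h)`, because `g` vanishes on the negative half-line. -/
theorem norm_sq_le_integral_apply_of_eq_zero {E : Type*} [NormedAddCommGroup E]
    [InnerProductSpace ℝ E] (ι : V →L[ℝ] E) {W : ℝ → StrongDual ℝ V} {w : ℝ → V} {g : ℝ → E}
    (hW : MemLp W 2) (hw : MemLp w 2) (hg : Continuous g) (hW0 : ∀ r ≤ 0, W r = 0)
    (hg0 : ∀ r ≤ 0, g r = 0) {T t : ℝ} (hgw : ∀ᵐ s, s < T → ι (w s) = g s)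
    (hgW : ∀ a b v, a ≤ b → inner ℝ (g b - g a) (ι v) = ∫ r in a..b, W r v)
    (ht0 : 0 ≤ t) (ht : t < T) :
    ‖g t‖ ^ 2 ≤ 2 * ∫ r in 0..t, W r (w r) := by
  refine le_of_forall_pos_le_add fun ε hε => ?_
  have hgc : Continuous fun s => ‖g s‖ ^ 2 := hg.norm.pow 2
  have ev1 : ∀ᶠ h in 𝓝[>] (0 : ℝ), ∀ s ∈ Icc t (t + h), ‖g t‖ ^ 2 - ε / 2 ≤ ‖g s‖ ^ 2 := by
    have h1 : ∀ᶠ s in 𝓝 t, ‖g t‖ ^ 2 - ε / 2 < ‖g s‖ ^ 2 :=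
      (hgc.tendsto t).eventually (lt_mem_nhds (by linarith))
    obtain ⟨δ, hδ, hball⟩ := Metric.eventually_nhds_iff.1 h1
    filter_upwards [Ioo_mem_nhdsGT hδ] with h hh s hs
    refine (hball ?_).le
    rw [Real.dist_eq, abs_lt]
    constructor <;> linarith [hs.1, hs.2, hh.1, hh.2]
  have ev2 := eventually_integral_translate_apply_translate_le hW hw hW0 (t := t)
    (show 0 < ε / 4 by linarith)
  have ev3 : ∀ᶠ h in 𝓝[>] (0 : ℝ), h < T - t ∧ 0 < h := by
    filter_upwards [Ioo_mem_nhdsGT (sub_pos.2 ht)] with h hh using ⟨hh.2, hh.1⟩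
  obtain ⟨h, hh1, hh2, hhT, hh0⟩ := (ev1.and (ev2.and ev3)).exists
  have hnt : -h ≤ t := by linarith
  have hvol : volume (Ioc 0 h) ≠ ⊤ := by simp
  have hB := integrable_translate_apply_translate hW hw h (Ioc (-h) t) (Ioc 0 h) hvol
  have hci : ∀ a b : ℝ, IntervalIntegrable (fun s => ‖g s‖ ^ 2) volume a b :=
    fun a b => hgc.intervalIntegrable a b
  have hci' : IntervalIntegrable (fun s => ‖g (s + h)‖ ^ 2) volume (-h) t :=
    (hgc.comp (continuous_id.add continuous_const)).intervalIntegrable _ _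
  have lower : h * (‖g t‖ ^ 2 - ε / 2) ≤
      ∫ s in (-h)..t, (‖g (s + h)‖ ^ 2 - ‖g s‖ ^ 2) := by
    have e0 : ∫ s in (-h)..0, ‖g s‖ ^ 2 = 0 := by
      refine intervalIntegral.integral_zero_ae (Eventually.of_forall fun r hr => ?_)
      rw [uIoc_of_le (by linarith)] at hr
      simp [hg0 r hr.2]
    have e1 := intervalIntegral.integral_add_adjacent_intervals (hci (-h) 0) (hci 0 t)
    have e2 := intervalIntegral.integral_add_adjacent_intervals (hci 0 t) (hci t (t + h))
    rw [intervalIntegral.integral_sub hci' (hci _ _),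
      intervalIntegral.integral_comp_add_right (fun s => ‖g s‖ ^ 2) h, neg_add_cancel]
    have e3 : ∫ _ in t..(t + h), (‖g t‖ ^ 2 - ε / 2) ≤ ∫ s in t..(t + h), ‖g s‖ ^ 2 :=
      intervalIntegral.integral_mono_on (by linarith) (by simp) (hci _ _) hh1
    rw [intervalIntegral.integral_const, smul_eq_mul] at e3
    have : t + h - t = h := by ring
    rw [this] at e3
    linarith
  have hI : IntervalIntegrable (fun s => ∫ σ in Ioc 0 h, W (s + σ) (w (s + h))) volume (-h) t := by
    rw [intervalIntegrable_iff_integrableOn_Ioc_of_le hnt]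
    exact hB.integral_prod_left
  have middle : ∫ s in (-h)..t, (‖g (s + h)‖ ^ 2 - ‖g s‖ ^ 2) ≤
      ∫ s in (-h)..t, 2 * ∫ σ in Ioc 0 h, W (s + σ) (w (s + h)) := by
    refine intervalIntegral.integral_mono_ae_restrict hnt (hci'.sub (hci _ _))
      (hI.const_mul 2) ?_
    have hshift : ∀ᵐ s, s + h < T → ι (w (s + h)) = g (s + h) :=
      (measurePreserving_add_right volume h).quasiMeasurePreserving.ae hgw
    filter_upwards [ae_restrict_of_ae hshift, ae_restrict_mem measurableSet_Icc] with s hs hsm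
    have hs' := hs (by linarith [hsm.2])
    have e1 : ∫ σ in Ioc 0 h, W (s + σ) (w (s + h)) =
        inner ℝ (g (s + h) - g s) (g (s + h)) := by
      rw [← intervalIntegral.integral_of_le hh0.le,
        intervalIntegral.integral_comp_add_left (fun r => W r (w (s + h))) s, add_zero,
        ← hgW s (s + h) (w (s + h)) (by linarith), hs']
    rw [e1]
    -- `2 ⟪a - b, a⟫ - ‖a‖² + ‖b‖² = ‖a - b‖²`
    have e2 := norm_sub_sq_real (g (s + h)) (g s)
    rw [inner_sub_left, real_inner_self_eq_norm_sq, real_inner_comm]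
    nlinarith [sq_nonneg ‖g (s + h) - g s‖]
  have swap : ∫ s in (-h)..t, 2 * ∫ σ in Ioc 0 h, W (s + σ) (w (s + h)) =
      2 * ∫ σ in 0..h, ∫ s in (-h)..t, W (s + σ) (w (s + h)) := by
    rw [intervalIntegral.integral_const_mul, intervalIntegral.integral_of_le hnt,
      intervalIntegral.integral_of_le hh0.le, integral_integral_swap hB]
    simp only [intervalIntegral.integral_of_le hnt]
  have upper : ∫ σ in 0..h, ∫ s in (-h)..t, W (s + σ) (w (s + h)) ≤
      h * ((∫ r in 0..t, W r (w r)) + ε / 4) := by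
    have e1 : ∫ σ in 0..h, ∫ s in (-h)..t, W (s + σ) (w (s + h)) ≤
        ∫ _ in 0..h, ((∫ r in 0..t, W r (w r)) + ε / 4) := by
      refine intervalIntegral.integral_mono_on hh0.le ?_ (by simp) hh2
      rw [intervalIntegrable_iff_integrableOn_Ioc_of_le hh0.le]
      simp only [intervalIntegral.integral_of_le hnt]
      exact hB.integral_prod_right
    rw [intervalIntegral.integral_const, smul_eq_mul, sub_zero] at e1
    exact e1
  have hfin : h * (‖g t‖ ^ 2 - ε / 2) ≤ h * (2 * ((∫ r in 0..t, W r (w r)) + ε / 4)) := by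
    linarith
  have := le_of_mul_le_mul_left hfin hh0
  linarith

end

theorem exists_memLp_extension {Y : Type*} [NormedAddCommGroup Y] {T : ℝ} {f : ℝ → Y}
    (hf : MemLp f 2 (timeMeasure T)) :
    ∃ f' : ℝ → Y, MemLp f' 2 ∧ (∀ r ∈ Ioo 0 T, f' r = f r) ∧ ∀ r, r ∉ Ioo 0 T → f' r = 0 :=
  ⟨(Ioo 0 T).indicator f, (memLp_indicator_iff_restrict measurableSet_Ioo).2 hf,
    fun _ hr => indicator_of_mem hr f, fun _ hr => indicator_of_notMem hr f⟩

/-- The energy inequality on `[0, T]` for a function `w` with values in `V` whose continuous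
representative `g` in `E` vanishes at `0` and has the derivative `W` in the dual of `V`. -/
theorem norm_sq_le_integral_apply {V E : Type*} [NormedAddCommGroup V] [InnerProductSpace ℝ V]
    [NormedAddCommGroup E] [InnerProductSpace ℝ E] (ι : V →L[ℝ] E) {T : ℝ}
    {W : ℝ → StrongDual ℝ V} {w : ℝ → V} {g : ℝ → E} (hT : 0 < T)
    (hW : MemLp W 2 (timeMeasure T)) (hw : MemLp w 2 (timeMeasure T))
    (hg : ContinuousOn g (Icc 0 T)) (hg0 : g 0 = 0)
    (hgw : (fun t => ι (w t)) =ᵐ[timeMeasure T] g)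
    (hgW : ∀ t ∈ Icc 0 T, ∀ v, inner ℝ (g t) (ι v) = ∫ r in 0..t, W r v)
    {t : ℝ} (ht : t ∈ Ico 0 T) :
    ‖g t‖ ^ 2 ≤ 2 * ∫ r in 0..t, W r (w r) := by
  -- Extend `g` by constants and `W`, `w` by zero: `g` then is a primitive of `W` on the whole line,
  -- whereas `ι w = g` persists only to the left of `T`.
  set e : ℝ → E := IccExtend hT.le ((Icc 0 T).domRestrict g) with he
  have he_cont : Continuous e := (continuousOn_iff_continuous_domRestrict.1 hg).Icc_extend'
  have he_eq : ∀ x ∈ Icc 0 T, e x = g x := fun x hx => IccExtend_of_mem _ _ hx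
  have he0 : ∀ r ≤ 0, e r = 0 := by
    intro r hr
    rw [he, IccExtend_of_le_left _ _ hr]
    exact hg0
  have heT : ∀ r, T ≤ r → e r = g T := fun r hr => by
    rw [he, IccExtend_of_right_le _ _ hr]
    rfl
  obtain ⟨W', hW', hWm, hWz⟩ := exists_memLp_extension hW
  obtain ⟨w', hw', hwm, hwz⟩ := exists_memLp_extension hw
  have hWi : ∀ (v : V) (a b : ℝ),
      IntervalIntegrable (fun r => W' r v) volume a b := by
    intro v a b
    have h1 := (hW'.locallyIntegrable one_le_two).integrableOn_isCompact
      (isCompact_uIcc (a := a) (b := b))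
    have h2 : IntegrableOn (fun r => W' r v) (uIcc a b) :=
      (ContinuousLinearMap.apply ℝ ℝ v).integrable_comp h1
    exact h2.intervalIntegrable
  have hprim_mem : ∀ (v : V) (b : ℝ), b ∈ Icc 0 T →
      ∫ r in 0..b, W' r v = ∫ r in 0..b, W r v := by
    intro v b hb
    simp only [intervalIntegral.integral_of_le hb.1, integral_Ioc_eq_integral_Ioo]
    refine setIntegral_congr_fun measurableSet_Ioo fun r hr => ?_
    have : r ∈ Ioo 0 T := ⟨hr.1, hr.2.trans_le hb.2⟩
    rw [hWm r this]
  have hzero : ∀ (v : V) (a b : ℝ), (∀ r ∈ uIoc a b, r ∉ Ioo 0 T) →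
      ∫ r in a..b, W' r v = 0 := by
    intro v a b hab
    refine intervalIntegral.integral_zero_ae (Eventually.of_forall fun r hr => ?_)
    rw [hWz r (hab r hr)]
    rfl
  have hprim : ∀ (v : V) (b : ℝ), inner ℝ (e b) (ι v) =
      ∫ r in 0..b, W' r v := by
    intro v b
    rcases le_total b 0 with hb | hb
    · rw [he0 b hb, inner_zero_left, hzero]
      intro r hr
      rw [uIoc_of_ge hb] at hr
      exact fun h => absurd h.1 (not_lt.2 hr.2)
    rcases le_total b T with hbT | hbT
    · rw [he_eq b ⟨hb, hbT⟩, hprim_mem v b ⟨hb, hbT⟩, hgW b ⟨hb, hbT⟩]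
    · rw [heT b hbT, hgW T ⟨hT.le, le_rfl⟩, ← hprim_mem v T ⟨hT.le, le_rfl⟩,
        ← intervalIntegral.integral_add_adjacent_intervals (hWi v 0 T) (hWi v T b),
        hzero v T b, add_zero]
      intro r hr
      rw [uIoc_of_le hbT] at hr
      exact fun h => absurd h.2 (not_lt.2 hr.1.le)
  have key := norm_sq_le_integral_apply_of_eq_zero (T := T) (t := t) ι hW' hw' he_cont
    (fun r hr => hWz r fun h => absurd h.1 (not_lt.2 hr)) he0 ?_ ?_ ht.1 ht.2
  · rw [he_eq t ⟨ht.1, ht.2.le⟩] at key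
    refine key.trans_eq ?_
    congr 1
    simp only [intervalIntegral.integral_of_le ht.1, integral_Ioc_eq_integral_Ioo]
    refine setIntegral_congr_fun measurableSet_Ioo fun r hr => ?_
    have : r ∈ Ioo 0 T := ⟨hr.1, hr.2.trans ht.2⟩
    rw [hWm r this, hwm r this]
  · have h1 := (ae_restrict_iff' measurableSet_Ioo).1 hgw
    filter_upwards [h1] with s hs hsT
    rcases le_or_gt s 0 with h0 | h0
    · rw [he0 s h0, hwz s fun h => absurd h.1 (not_lt.2 h0), map_zero]
    · have hm : s ∈ Ioo 0 T := ⟨h0, hsT⟩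
      rw [hwm s hm, hs hm, he_eq s (Ioo_subset_Icc_self hm)]
  · intro a b v _
    rw [inner_sub_left, hprim, hprim, sub_eq_iff_eq_add, add_comm,
      intervalIntegral.integral_add_adjacent_intervals (hWi v 0 a) (hWi v a b)]

/-- The energy inequality for the difference of two functions in `L²(0, T; V)` with weak derivatives
in `L²(0, T; V')` and continuous representatives `g₁` and `g₂` that agree at `0`. -/
theorem norm_sub_sq_le_integral_apply {V E : Type*} [NormedAddCommGroup V] [InnerProductSpace ℝ V]
    [NormedAddCommGroup E] [InnerProductSpace ℝ E] (ι : V →L[ℝ] E) {T : ℝ} (hT : 0 < T)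
    {u₁ u₂ : ℝ → V} {u₁' u₂' : ℝ → StrongDual ℝ V} {g₁ g₂ : ℝ → E}
    (hu₁ : MemLp u₁ 2 (timeMeasure T)) (hu₂ : MemLp u₂ 2 (timeMeasure T))
    (hu₁' : MemLp u₁' 2 (timeMeasure T)) (hu₂' : MemLp u₂' 2 (timeMeasure T))
    (h₁ : HasWeakTimeDeriv T (fun t => (innerSL ℝ (ι (u₁ t))).comp ι) u₁')
    (h₂ : HasWeakTimeDeriv T (fun t => (innerSL ℝ (ι (u₂ t))).comp ι) u₂')
    (hg₁ : ContinuousOn g₁ (Icc 0 T)) (hg₂ : ContinuousOn g₂ (Icc 0 T))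
    (hgu₁ : g₁ =ᵐ[timeMeasure T] fun t => ι (u₁ t))
    (hgu₂ : g₂ =ᵐ[timeMeasure T] fun t => ι (u₂ t)) (h0 : g₁ 0 = g₂ 0) {t : ℝ}
    (ht : t ∈ Ico 0 T) :
    ‖g₁ t - g₂ t‖ ^ 2 ≤ 2 * ∫ r in 0..t, (u₁' r - u₂' r) (u₁ r - u₂ r) := by
  have : IsFiniteMeasure (timeMeasure T) := by unfold timeMeasure; infer_instance
  have hrep : ∀ {u : ℝ → V} {u' : ℝ → StrongDual ℝ V} {g : ℝ → E},
      MemLp u' 2 (timeMeasure T) →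
      HasWeakTimeDeriv T (fun t => (innerSL ℝ (ι (u t))).comp ι) u' →
      ContinuousOn g (Icc 0 T) → (g =ᵐ[timeMeasure T] fun t => ι (u t)) →
      ∀ s ∈ Icc 0 T, ∀ v, IntervalIntegrable (fun r => u' r v) volume 0 s ∧
        inner ℝ (g s - g 0) (ι v) = ∫ r in 0..s, u' r v := by
    intro u u' g hu' h hg hgu s hs v
    have hint : Integrable u' (timeMeasure T) := hu'.integrable one_le_two
    have hc : ContinuousOn (fun t => (innerSL ℝ (g t)).comp ι) (Icc 0 T) :=
      ((innerSL ℝ).continuous.comp_continuousOn hg).clm_comp continuousOn_const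
    have key := h.sub_eq_integral hint hT hc (by
      filter_upwards [hgu] with r hr
      rw [hr]) hs
    have hI : IntervalIntegrable u' volume 0 s :=
      intervalIntegrable_of_timeMeasure hint ⟨le_rfl, hT.le⟩ hs
    refine ⟨intervalIntegrable_of_timeMeasure
      ((ContinuousLinearMap.apply ℝ ℝ v).integrable_comp hint) ⟨le_rfl, hT.le⟩ hs, ?_⟩
    rw [← ContinuousLinearMap.intervalIntegral_apply hI, ← key]
    simp [inner_sub_left]
  refine norm_sq_le_integral_apply (g := fun t => g₁ t - g₂ t) (W := fun r => u₁' r - u₂' r)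
    (w := fun r => u₁ r - u₂ r) ι hT (hu₁'.sub hu₂') (hu₁.sub hu₂) (hg₁.sub hg₂)
    (sub_eq_zero.2 h0) ?_ ?_ ht
  · filter_upwards [hgu₁, hgu₂] with r e1 e2
    rw [e1, e2, map_sub]
  · intro s hs v
    obtain ⟨i1, e1⟩ := hrep hu₁' h₁ hg₁ hgu₁ s hs v
    obtain ⟨i2, e2⟩ := hrep hu₂' h₂ hg₂ hgu₂ s hs v
    simp only [sub_apply]
    rw [intervalIntegral.integral_sub i1 i2, ← e1, ← e2, ← inner_sub_left, h0]
    congr 1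
    abel

/-- The energy inequality for the primitive `g` of a function in `L²(0, T; E)`. -/
theorem norm_sq_le_integral_inner {E : Type*} [NormedAddCommGroup E] [InnerProductSpace ℝ E]
    [CompleteSpace E] {T : ℝ} (hT : 0 < T) {f f' g : ℝ → E} (hf : MemLp f 2 (timeMeasure T))
    (hf' : MemLp f' 2 (timeMeasure T)) (hg : ContinuousOn g (Icc 0 T))
    (hgf : f =ᵐ[timeMeasure T] g) (h : ∀ t ∈ Icc 0 T, g t = ∫ r in 0..t, f' r)
    {t : ℝ} (ht : t ∈ Ico 0 T) :
    ‖g t‖ ^ 2 ≤ 2 * ∫ r in 0..t, inner ℝ (f' r) (f r) := by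
  have : IsFiniteMeasure (timeMeasure T) := by unfold timeMeasure; infer_instance
  have hW : MemLp (fun r => innerSL ℝ (f' r)) 2 (timeMeasure T) :=
    hf'.of_le ((innerSL ℝ).continuous.comp_aestronglyMeasurable hf'.1)
      (Eventually.of_forall fun r => (innerSL_apply_norm ℝ (f' r)).le)
  refine norm_sq_le_integral_apply (ContinuousLinearMap.id ℝ E) hT hW hf hg ?_ hgf ?_ ht
  · rw [h 0 ⟨le_rfl, hT.le⟩, intervalIntegral.integral_same]
  · intro s hs v
    have hI : IntervalIntegrable f' volume 0 s :=
      intervalIntegrable_of_timeMeasure (hf'.integrable one_le_two) ⟨le_rfl, hT.le⟩ hs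
    have := (innerSL ℝ v).intervalIntegral_comp_comm hI
    simp only [innerSL_apply_apply] at this
    rw [h s hs, ContinuousLinearMap.id_apply, real_inner_comm, ← this]
    simp only [innerSL_apply_apply, real_inner_comm]

/-! ### Bounded weak derivatives and Lipschitz continuity -/

open scoped Convolution in
/-- The derivative of a mollification is the mollification of the weak derivative, and averages
preserve the bound on the latter. -/
theorem IsWeakPartial.norm_fderiv_mollification_apply_le {X Y : Type*} [NormedAddCommGroup X]
    [NormedSpace ℝ X] [FiniteDimensional ℝ X] [MeasureSpace X] [BorelSpace X]
    [(volume : Measure X).IsAddHaarMeasure] [NormedAddCommGroup Y] [NormedSpace ℝ Y]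
    {f g : X → Y} {v : X} (hfg : IsWeakPartial univ v f g) (φ : ContDiffBump (0 : X)) {c : ℝ}
    (hc : ∀ᵐ x, ‖g x‖ ≤ c) (x : X) :
    ‖fderiv ℝ (f ⋆[(ContinuousLinearMap.lsmul ℝ ℝ).flip, volume] φ.normed volume) x v‖ ≤ c := by
  have hf : LocallyIntegrable f := locallyIntegrableOn_univ.1 hfg.1
  have hρ : ContDiff ℝ ∞ (φ.normed volume) := φ.contDiff_normed
  have hρc : HasCompactSupport (φ.normed volume) := φ.hasCompactSupport_normed
  rw [(hρc.hasFDerivAt_convolution_right _ hf (hρ.of_le (by norm_cast)) x).fderiv,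
    convolution_precompR_apply _ hf (hρc.fderiv ℝ) (hρ.continuous_fderiv (by simp))]
  set ψ : X → ℝ := fun t => φ.normed volume (x - t) with hψ
  have hψtest : IsTestFunction univ ψ := by
    refine ⟨hρ.comp (contDiff_const.sub contDiff_id), ?_, subset_univ _⟩
    exact hρc.comp_homeomorph (Homeomorph.subLeft x)
  have hψd : ∀ t, fderiv ℝ ψ t v = -fderiv ℝ (φ.normed volume) (x - t) v := by
    intro t
    have h1 : HasFDerivAt (fun t : X => x - t) (-ContinuousLinearMap.id ℝ X) t :=
      (hasFDerivAt_id t).const_sub x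
    have h2 := ((hρ.differentiable (by simp)) (x - t)).hasFDerivAt.comp t h1
    have h3 : HasFDerivAt ψ _ t := h2
    rw [h3.fderiv]
    simp
  have key := hfg.2.2 ψ hψtest
  simp only [Measure.restrict_univ, hψd, neg_smul, integral_neg, neg_inj] at key
  have e1 : (f ⋆[(ContinuousLinearMap.lsmul ℝ ℝ).flip, volume]
      fun a => fderiv ℝ (φ.normed volume) a v) x = ∫ t, ψ t • g t := by
    rw [← key]
    rfl
  rw [e1]
  have hψ1 : ∫ t, ψ t = 1 := by
    rw [hψ, integral_sub_left_eq_self (φ.normed volume) volume x, φ.integral_normed]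
  have hψi : Integrable ψ := (φ.integrable_normed (μ := volume)).comp_sub_left x
  calc ‖∫ t, ψ t • g t‖ ≤ ∫ t, ψ t * c := by
        refine norm_integral_le_of_norm_le (hψi.mul_const c) ?_
        filter_upwards [hc] with t ht
        rw [norm_smul, Real.norm_of_nonneg (φ.nonneg_normed _)]
        exact mul_le_mul_of_nonneg_left ht (φ.nonneg_normed _)
    _ = c := by rw [integral_mul_const, hψ1, one_mul]

open scoped Convolution in
/-- A continuous function with essentially bounded weak partial derivatives is Lipschitz continuous:
its mollifications are, with a common constant. -/
theorem norm_sub_le_of_isWeakPartial {J Y : Type*} [Fintype J] [DecidableEq J]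
    [NormedAddCommGroup Y] [NormedSpace ℝ Y] [CompleteSpace Y]
    {f : EuclideanSpace ℝ J → Y} {f' : J → EuclideanSpace ℝ J → Y} (hf : Continuous f)
    (hf' : ∀ r, IsWeakPartial univ (EuclideanSpace.single r (1 : ℝ)) f (f' r)) {c : ℝ}
    (hc0 : 0 ≤ c) (hc : ∀ r, ∀ᵐ x, ‖f' r x‖ ≤ c) (x y : EuclideanSpace ℝ J) :
    ‖f x - f y‖ ≤ Fintype.card J * c * ‖x - y‖ := by
  set φ : ℕ → ContDiffBump (0 : EuclideanSpace ℝ J) := fun n =>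
    ⟨1 / (n + 1), 2 * (1 / (n + 1)), by positivity, by
      have : (0 : ℝ) < 1 / (n + 1) := by positivity
      linarith⟩ with hφ
  set m : ℕ → EuclideanSpace ℝ J → Y := fun n =>
    f ⋆[(ContinuousLinearMap.lsmul ℝ ℝ).flip, volume] (φ n).normed volume with hm
  have hlim : ∀ z, Tendsto (fun n => m n z) atTop (𝓝 (f z)) := by
    intro z
    have h0 : Tendsto (fun n => (φ n).rOut) atTop (𝓝 0) := by
      have := (tendsto_one_div_add_atTop_nhds_zero_nat (𝕜 := ℝ)).const_mul 2
      rwa [mul_zero] at this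
    have := ContDiffBump.convolution_tendsto_right_of_continuous (μ := volume) h0 hf z
    refine this.congr fun n => ?_
    rw [hm, ← convolution_flip]
  have hbound : ∀ n z, ‖fderiv ℝ (m n) z‖ ≤ Fintype.card J * c := by
    intro n z
    refine ContinuousLinearMap.opNorm_le_bound _ (by positivity) fun v => ?_
    have hv : v = ∑ r, v r • EuclideanSpace.single r (1 : ℝ) := by
      ext i
      simp [Finset.sum_apply, Pi.single_apply]
    calc ‖fderiv ℝ (m n) z v‖
        = ‖∑ r, v r • fderiv ℝ (m n) z (EuclideanSpace.single r (1 : ℝ))‖ := by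
          conv_lhs => rw [hv, map_sum]
          simp only [map_smul]
      _ ≤ ∑ r : J, ‖v‖ * c := by
          refine norm_sum_le_of_le _ fun r _ => ?_
          rw [norm_smul]
          exact mul_le_mul (PiLp.norm_apply_le v r)
            ((hf' r).norm_fderiv_mollification_apply_le (φ n) (hc r) z) (norm_nonneg _)
            (norm_nonneg _)
      _ = Fintype.card J * c * ‖v‖ := by
          rw [Finset.sum_const, Finset.card_univ, nsmul_eq_mul]
          ring
  have hdiff : ∀ n z, DifferentiableAt ℝ (m n) z := fun n z =>
    ((φ n).hasCompactSupport_normed.hasFDerivAt_convolution_right _ hf.locallyIntegrable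
      ((φ n).contDiff_normed) z).differentiableAt
  have hm' : ∀ n, ‖m n x - m n y‖ ≤ Fintype.card J * c * ‖x - y‖ := fun n =>
    convex_univ.norm_image_sub_le_of_norm_fderiv_le (fun z _ => hdiff n z)
      (fun z _ => hbound n z) (mem_univ y) (mem_univ x)
  exact le_of_tendsto ((hlim x).sub (hlim y)).norm (Eventually.of_forall hm')

/-! ### Estimates for the diffusion form and the relaxation equation -/

section Tensor

variable {d k : ℕ}

theorem SymTensor.apply_sub (H : SymTensor k d) (D E : Mat k d) :
    H.apply (D - E) = H.apply D - H.apply E := by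
  ext p
  simp [SymTensor.apply, mul_sub]

theorem SymTensor.sub_apply (H K : SymTensor k d) (D : Mat k d) :
    (H - K).apply D = H.apply D - K.apply D := by
  ext p
  simp [SymTensor.apply, sub_mul]

theorem SymTensor.norm_apply_le (H : SymTensor k d) (D : Mat k d) :
    ‖H.apply D‖ ≤ ‖H‖ * ‖D‖ := by
  refine abs_le_of_sq_le_sq' ?_ (by positivity) |>.2
  have e1 : ‖H‖ ^ 2 = ∑ p, ∑ q, H.1 (p, q) ^ 2 := by
    rw [Submodule.coe_norm, EuclideanSpace.real_norm_sq_eq, Fintype.sum_prod_type]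
  rw [mul_pow, EuclideanSpace.real_norm_sq_eq, EuclideanSpace.real_norm_sq_eq D, e1,
    Finset.sum_mul]
  exact Finset.sum_le_sum fun p _ => Finset.sum_mul_sq_le_sq_mul_sq _ _ _

theorem SymTensor.continuous_apply :
    Continuous fun z : SymTensor k d × Mat k d => z.1.apply z.2 := by
  refine (PiLp.continuous_toLp 2 _).comp (continuous_pi fun p => ?_)
  fun_prop

theorem SymTensor.abs_inner_apply_le (H : SymTensor k d) (D E : Mat k d) :
    |inner ℝ (H.apply D) E| ≤ ‖H‖ * ‖D‖ * ‖E‖ :=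
  (abs_real_inner_le_norm _ _).trans
    (mul_le_mul_of_nonneg_right (H.norm_apply_le D) (norm_nonneg _))

/-- The coercivity of the difference of two fluxes: for `D = D₁ - D₂`, the flux difference
`H₁ D₁ - H₂ D₂` equals `H₁ D + (H₁ - H₂) D₂`, and Young's inequality absorbs the second term. -/
theorem SymTensor.le_inner_apply_sub {H₁ H₂ : SymTensor k d} {D₁ D₂ : Mat k d} {κ M : ℝ}
    (hκ : 0 < κ) (hH : H₁ ∈ symTensorsGe k d κ) (hD : ‖D₂‖ ≤ M) :
    κ / 2 * ‖D₁ - D₂‖ ^ 2 - M ^ 2 / (2 * κ) * ‖H₁ - H₂‖ ^ 2 ≤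
      inner ℝ (H₁.apply D₁) (D₁ - D₂) - inner ℝ (H₂.apply D₂) (D₁ - D₂) := by
  have e : inner ℝ (H₁.apply D₁) (D₁ - D₂) - inner ℝ (H₂.apply D₂) (D₁ - D₂) =
      inner ℝ (H₁.apply (D₁ - D₂)) (D₁ - D₂) + inner ℝ ((H₁ - H₂).apply D₂) (D₁ - D₂) := by
    rw [SymTensor.apply_sub, SymTensor.sub_apply, inner_sub_left, inner_sub_left]
    ring
  have h1 := hH (D₁ - D₂)
  rw [real_inner_self_eq_norm_sq] at h1
  have h2 := (abs_le.1 ((H₁ - H₂).abs_inner_apply_le D₂ (D₁ - D₂))).1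
  have h3 : ‖H₁ - H₂‖ * ‖D₂‖ * ‖D₁ - D₂‖ ≤ ‖H₁ - H₂‖ * M * ‖D₁ - D₂‖ := by gcongr
  have h4 : 0 ≤ (2 * κ)⁻¹ * (κ * ‖D₁ - D₂‖ - M * ‖H₁ - H₂‖) ^ 2 := by positivity
  have h5 : (2 * κ)⁻¹ * (κ * ‖D₁ - D₂‖ - M * ‖H₁ - H₂‖) ^ 2 =
      κ / 2 * ‖D₁ - D₂‖ ^ 2 - ‖H₁ - H₂‖ * M * ‖D₁ - D₂‖ +
        M ^ 2 / (2 * κ) * ‖H₁ - H₂‖ ^ 2 := by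
    field_simp
    ring
  rw [e]
  linarith

end Tensor

/-- The embedding of `L^∞` into `L²` over a finite measure space. -/
noncomputable def linftyToL2 {X Y : Type*} [MeasurableSpace X] (μ : Measure X) [IsFiniteMeasure μ]
    [NormedAddCommGroup Y] [NormedSpace ℝ Y] : Lp Y ⊤ μ →L[ℝ] Lp Y 2 μ :=
  LinearMap.mkContinuous
    { toFun := fun f => ((Lp.memLp f).mono_exponent le_top).toLp f
      map_add' := fun f g => by
        rw [← MemLp.toLp_add]
        exact MemLp.toLp_congr _ _ (Lp.coeFn_add f g)
      map_smul' := fun c f => by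
        rw [RingHom.id_apply, ← MemLp.toLp_const_smul]
        exact MemLp.toLp_congr _ _ (Lp.coeFn_smul c f) }
    (μ.real univ ^ (1 / (2 : ℝ))) fun f => by
      have h1 := eLpNorm_le_eLpNorm_mul_rpow_measure_univ (p := 2) (q := ⊤) le_top
        (Lp.aestronglyMeasurable f)
      simp only [LinearMap.coe_mk, AddHom.coe_mk, Lp.norm_toLp]
      rw [Lp.norm_def, mul_comm, Measure.real, ENNReal.toReal_rpow, ← ENNReal.toReal_mul]
      refine ENNReal.toReal_mono (ENNReal.mul_ne_top (Lp.eLpNorm_ne_top f) ?_) ?_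
      · exact ENNReal.rpow_ne_top_of_nonneg (by positivity) (measure_ne_top _ _)
      · simpa using h1

theorem coeFn_linftyToL2 {X Y : Type*} [MeasurableSpace X] {μ : Measure X} [IsFiniteMeasure μ]
    [NormedAddCommGroup Y] [NormedSpace ℝ Y] (f : Lp Y ⊤ μ) : linftyToL2 μ f =ᵐ[μ] f :=
  ((Lp.memLp f).mono_exponent le_top).coeFn_toLp

theorem linftyToL2_injective {X Y : Type*} [MeasurableSpace X] {μ : Measure X} [IsFiniteMeasure μ]
    [NormedAddCommGroup Y] [NormedSpace ℝ Y] :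
    Function.Injective (linftyToL2 μ : Lp Y ⊤ μ →L[ℝ] Lp Y 2 μ) := fun f g hfg => by
  refine Lp.ext ((coeFn_linftyToL2 f).symm.trans ?_)
  rw [hfg]
  exact coeFn_linftyToL2 g

section Form

variable {d k : ℕ} {G : Set (Space d)}

theorem integrable_aForm (H : LinftySym G k) (u v : spaceV G k) :
    Integrable (fun x => inner ℝ ((H x).apply (grad u x)) (grad v x)) (volume.restrict G) := by
  have hu := integrable_norm_sq (Lp.memLp (grad u))
  have hv := integrable_norm_sq (Lp.memLp (grad v))
  refine ((hu.add hv).const_mul ‖H‖).mono' ?_ ?_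
  · have h1 : AEStronglyMeasurable (fun x => (H x).apply (grad u x)) (volume.restrict G) :=
      SymTensor.continuous_apply.comp_aestronglyMeasurable
        ((Lp.aestronglyMeasurable H).prodMk (Lp.aestronglyMeasurable (grad u)))
    exact h1.inner (Lp.aestronglyMeasurable (grad v))
  · have hH : ∀ᵐ x ∂(volume.restrict G), ‖H x‖ ≤ ‖H‖ := by
      have := ae_le_eLpNormEssSup (f := H) (μ := volume.restrict G)
      filter_upwards [this] with x hx
      rw [Lp.norm_def, eLpNorm_exponent_top, ← toReal_enorm]
      refine ENNReal.toReal_mono ?_ hx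
      have := Lp.eLpNorm_ne_top H
      rwa [eLpNorm_exponent_top] at this
    filter_upwards [hH] with x hx
    refine ((H x).abs_inner_apply_le _ _).trans ?_
    simp only [Pi.add_apply]
    rw [mul_assoc]
    refine mul_le_mul hx ?_ (by positivity) (norm_nonneg H)
    nlinarith [sq_nonneg (‖grad u x‖ - ‖grad v x‖), sq_nonneg ‖grad u x‖, sq_nonneg ‖grad v x‖]

theorem coeFn_grad_sub (u v : spaceV G k) :
    grad (u - v) =ᵐ[volume.restrict G] fun x => grad u x - grad v x :=
  Lp.coeFn_sub (grad u) (grad v)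

variable [IsFiniteMeasure ((volume : Measure (Space d)).restrict G)]

theorem le_aForm_sub_aForm {H₁ H₂ : LinftySym G k} {u₁ u₂ : spaceV G k} {κ M : ℝ} (hκ : 0 < κ)
    (hH : ∀ᵐ x ∂(volume.restrict G), H₁ x ∈ symTensorsGe k d κ)
    (hu : ∀ᵐ x ∂(volume.restrict G), ‖grad u₂ x‖ ≤ M) :
    κ / 2 * ‖grad (u₁ - u₂)‖ ^ 2 -
        M ^ 2 / (2 * κ) * ‖linftyToL2 (volume.restrict G) (H₁ - H₂)‖ ^ 2 ≤
      aForm H₁ u₁ (u₁ - u₂) - aForm H₂ u₂ (u₁ - u₂) := by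
  have i1 := (integrable_norm_sq (Lp.memLp (grad (u₁ - u₂)))).const_mul (κ / 2)
  have i2 := (integrable_norm_sq (Lp.memLp
    (linftyToL2 (volume.restrict G) (H₁ - H₂)))).const_mul (M ^ 2 / (2 * κ))
  rw [norm_sq_eq_integral_norm_sq, norm_sq_eq_integral_norm_sq, ← integral_const_mul,
    ← integral_const_mul, ← integral_sub i1 i2, aForm, aForm,
    ← integral_sub (integrable_aForm _ _ _) (integrable_aForm _ _ _)]
  refine integral_mono_ae (i1.sub i2)
    ((integrable_aForm _ _ _).sub (integrable_aForm _ _ _)) ?_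
  filter_upwards [hH, hu, coeFn_grad_sub u₁ u₂, coeFn_linftyToL2 (H₁ - H₂),
    Lp.coeFn_sub H₁ H₂] with x h1 h2 h3 h4 h5
  simp only [Pi.sub_apply] at h5 ⊢
  rw [h4, h5, h3]
  exact SymTensor.le_inner_apply_sub hκ h1 h2

theorem norm_relaxation_sub_le {F : Mat k d → SymTensor k d} {L τ : ℝ}
    (hF : ∀ D E, ‖F D - F E‖ ≤ L * ‖D - E‖) {H₁ H₂ H₁' H₂' : LinftySym G k} {u₁ u₂ : spaceV G k}
    (h₁ : ∀ᵐ x ∂(volume.restrict G), τ • H₁' x + H₁ x - F (grad u₁ x) = 0)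
    (h₂ : ∀ᵐ x ∂(volume.restrict G), τ • H₂' x + H₂ x - F (grad u₂ x) = 0) :
    ‖τ • linftyToL2 (volume.restrict G) (H₁' - H₂') +
        linftyToL2 (volume.restrict G) (H₁ - H₂)‖ ≤ L * ‖grad (u₁ - u₂)‖ := by
  rw [← map_smul, ← map_add]
  refine Lp.norm_le_mul_norm_of_ae_le_mul ?_
  filter_upwards [h₁, h₂, coeFn_grad_sub u₁ u₂,
    coeFn_linftyToL2 (τ • (H₁' - H₂') + (H₁ - H₂)),
    Lp.coeFn_add (τ • (H₁' - H₂')) (H₁ - H₂), Lp.coeFn_smul τ (H₁' - H₂'),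
    Lp.coeFn_sub H₁ H₂, Lp.coeFn_sub H₁' H₂'] with x e1 e2 e3 e4 e5 e6 e7 e8
  rw [e4, e5, e3, Pi.add_apply, e6, e7, Pi.smul_apply, e8, Pi.sub_apply, Pi.sub_apply]
  have : τ • (H₁' x - H₂' x) + (H₁ x - H₂ x) = F (grad u₁ x) - F (grad u₂ x) := by
    rw [← sub_eq_zero.1 e1, ← sub_eq_zero.1 e2, smul_sub]
    abel
  rw [this]
  exact hF _ _

end Form

/-! ### An abstract comparison principle -/

/-- Grönwall's inequality in integral form, for a homogeneous bound. -/
theorem eq_zero_of_le_mul_integral {ρ : ℝ → ℝ} {T C : ℝ} (hρ : ContinuousOn ρ (Icc 0 T))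
    (hρ0 : ∀ t ∈ Icc 0 T, 0 ≤ ρ t) (h : ∀ t ∈ Ico 0 T, ρ t ≤ C * ∫ r in 0..t, ρ r)
    {t : ℝ} (ht : t ∈ Ico 0 T) : ρ t = 0 := by
  have hT : 0 ≤ T := ht.1.trans ht.2.le
  set e : ℝ → ℝ := IccExtend hT ((Icc 0 T).domRestrict ρ) with he
  have he_cont : Continuous e := (continuousOn_iff_continuous_domRestrict.1 hρ).Icc_extend'
  have he_eq : ∀ x ∈ Icc 0 T, e x = ρ x := fun x hx => IccExtend_of_mem _ _ hx
  have hint : ∀ s ∈ Icc 0 T, ∫ r in 0..s, ρ r = ∫ r in 0..s, e r := by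
    intro s hs
    refine intervalIntegral.integral_congr fun r hr => (he_eq r ?_).symm
    rw [uIcc_of_le hs.1] at hr
    exact ⟨hr.1, hr.2.trans hs.2⟩
  have hderiv : ∀ s, HasDerivAt (fun s => ∫ r in 0..s, e r) (e s) s := fun s =>
    intervalIntegral.integral_hasDerivAt_right (he_cont.intervalIntegrable _ _)
      (he_cont.stronglyMeasurableAtFilter _ _) he_cont.continuousAt
  have hpos : ∀ s ∈ Icc 0 T, 0 ≤ ∫ r in 0..s, e r := fun s hs =>
    intervalIntegral.integral_nonneg hs.1 fun r hr => by
      have hr' : r ∈ Icc 0 T := ⟨hr.1, hr.2.trans hs.2⟩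
      rw [he_eq r hr']
      exact hρ0 r hr'
  have hzero := eq_zero_of_abs_deriv_le_mul_abs_self_of_eq_zero_right (a := 0) (b := T) (K := C)
    (f := fun s => ∫ r in 0..s, e r) (f' := e)
    (fun s _ => (hderiv s).continuousAt.continuousWithinAt)
    (fun s _ => (hderiv s).hasDerivWithinAt) (by simp) (fun s hs => by
      have hs' : s ∈ Icc 0 T := Ico_subset_Icc_self hs
      rw [Real.norm_of_nonneg (hpos s hs'), he_eq s hs', Real.norm_of_nonneg (hρ0 s hs'),
        ← hint s hs']
      exact h s hs) t (Ico_subset_Icc_self ht)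
  have h1 := h t ht
  rw [hint t (Ico_subset_Icc_self ht), hzero, mul_zero] at h1
  exact le_antisymm h1 (hρ0 t (Ico_subset_Icc_self ht))

theorem intervalIntegral_mono_of_timeMeasure {T : ℝ} {f g : ℝ → ℝ} {t : ℝ} (ht : t ∈ Ico 0 T)
    (hf : IntervalIntegrable f volume 0 t) (hg : IntervalIntegrable g volume 0 t)
    (h : ∀ᵐ r ∂(timeMeasure T), f r ≤ g r) : ∫ r in 0..t, f r ≤ ∫ r in 0..t, g r := by
  refine intervalIntegral.integral_mono_ae_restrict ht.1 hf hg ?_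
  rw [← restrict_Ioo_eq_restrict_Icc]
  exact ae_mono (Measure.restrict_mono_set _ (Ioo_subset_Ioo_right ht.2.le)) h

/-- The coercive equation for `u`: the difference of the gradients `D u` is controlled by the
difference of the coefficients. -/
theorem norm_sub_sq_add_integral_le {E V P S : Type*} [NormedAddCommGroup E]
    [InnerProductSpace ℝ E] [NormedAddCommGroup V] [InnerProductSpace ℝ V] [NormedAddCommGroup P]
    [NormedSpace ℝ P] [NormedAddCommGroup S] (K : V →L[ℝ] E) (D : V →L[ℝ] P) {T A B : ℝ}
    (hT : 0 < T)
    {u₁ u₂ : ℝ → V} {u₁' u₂' : ℝ → StrongDual ℝ V} {g₁ g₂ : ℝ → E} {η : ℝ → S}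
    (hu₁ : MemLp u₁ 2 (timeMeasure T)) (hu₂ : MemLp u₂ 2 (timeMeasure T))
    (hu₁' : MemLp u₁' 2 (timeMeasure T)) (hu₂' : MemLp u₂' 2 (timeMeasure T))
    (hd₁ : HasWeakTimeDeriv T (fun t => (innerSL ℝ (K (u₁ t))).comp K) u₁')
    (hd₂ : HasWeakTimeDeriv T (fun t => (innerSL ℝ (K (u₂ t))).comp K) u₂')
    (hg₁ : ContinuousOn g₁ (Icc 0 T)) (hg₂ : ContinuousOn g₂ (Icc 0 T))
    (hgu₁ : g₁ =ᵐ[timeMeasure T] fun t => K (u₁ t))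
    (hgu₂ : g₂ =ᵐ[timeMeasure T] fun t => K (u₂ t)) (h0 : g₁ 0 = g₂ 0)
    (hη : ContinuousOn η (Icc 0 T))
    (he : ∀ᵐ r ∂(timeMeasure T), (u₁' r - u₂' r) (u₁ r - u₂ r) ≤
      A * ‖η r‖ ^ 2 - B * ‖D (u₁ r - u₂ r)‖ ^ 2)
    {t : ℝ} (ht : t ∈ Ico 0 T) :
    ‖g₁ t - g₂ t‖ ^ 2 + 2 * B * ∫ r in 0..t, ‖D (u₁ r - u₂ r)‖ ^ 2 ≤
      2 * A * ∫ r in 0..t, ‖η r‖ ^ 2 := by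
  have htm : t ∈ Icc 0 T := Ico_subset_Icc_self ht
  have h0m : (0 : ℝ) ∈ Icc 0 T := ⟨le_rfl, hT.le⟩
  have henergy := norm_sub_sq_le_integral_apply K hT hu₁ hu₂ hu₁' hu₂' hd₁ hd₂ hg₁ hg₂
    hgu₁ hgu₂ h0 ht
  have iW : IntervalIntegrable (fun r => (u₁' r - u₂' r) (u₁ r - u₂ r)) volume 0 t :=
    intervalIntegrable_of_timeMeasure (integrable_apply (hu₁'.sub hu₂') (hu₁.sub hu₂)) h0m htm
  have iq : IntervalIntegrable (fun r => ‖D (u₁ r - u₂ r)‖ ^ 2) volume 0 t :=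
    intervalIntegrable_of_timeMeasure (integrable_norm_sq (D.comp_memLp' (hu₁.sub hu₂))) h0m htm
  have iρ : IntervalIntegrable (fun r => ‖η r‖ ^ 2) volume 0 t := by
    refine ContinuousOn.intervalIntegrable ?_
    rw [uIcc_of_le ht.1]
    exact (hη.norm.pow 2).mono (Icc_subset_Icc_right ht.2.le)
  have hmono := intervalIntegral_mono_of_timeMeasure ht iW
    ((iρ.const_mul A).sub (iq.const_mul B)) he
  rw [intervalIntegral.integral_sub (iρ.const_mul _) (iq.const_mul _),
    intervalIntegral.integral_const_mul, intervalIntegral.integral_const_mul] at hmono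
  linarith

/-- The relaxation equation for the coefficients: their difference, measured in `S`, is controlled
by the difference `Q` of the gradients. Testing with the difference itself yields a bound without a
zeroth order term, since `- ‖b‖² + L ‖Q‖ ‖b‖ ≤ L² ‖Q‖² / 4`. -/
theorem norm_sub_sq_le_of_relaxation {P Y S : Type*} [NormedAddCommGroup P]
    [NormedAddCommGroup Y] [NormedSpace ℝ Y] [CompleteSpace Y] [NormedAddCommGroup S]
    [InnerProductSpace ℝ S] [CompleteSpace S] (ι : Y →L[ℝ] S) {T τ L : ℝ} (hT : 0 < T)
    (hτ : 0 < τ)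
    {H₁ H₂ H₁' H₂' η₁ η₂ : ℝ → Y} {Q : ℝ → P} (hQ : MemLp Q 2 (timeMeasure T))
    (hH₁ : MemLp H₁ 2 (timeMeasure T)) (hH₂ : MemLp H₂ 2 (timeMeasure T))
    (hH₁' : MemLp H₁' 2 (timeMeasure T)) (hH₂' : MemLp H₂' 2 (timeMeasure T))
    (hd₁ : HasWeakTimeDeriv T H₁ H₁') (hd₂ : HasWeakTimeDeriv T H₂ H₂')
    (hη₁ : ContinuousOn η₁ (Icc 0 T)) (hη₂ : ContinuousOn η₂ (Icc 0 T))
    (hηH₁ : η₁ =ᵐ[timeMeasure T] H₁) (hηH₂ : η₂ =ᵐ[timeMeasure T] H₂) (h0 : η₁ 0 = η₂ 0)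
    (he : ∀ᵐ r ∂(timeMeasure T),
      ‖τ • ι (H₁' r - H₂' r) + ι (H₁ r - H₂ r)‖ ≤ L * ‖Q r‖)
    {t : ℝ} (ht : t ∈ Ico 0 T) :
    ‖ι (η₁ t - η₂ t)‖ ^ 2 ≤ L ^ 2 / (2 * τ) * ∫ r in 0..t, ‖Q r‖ ^ 2 := by
  have : IsFiniteMeasure (timeMeasure T) := by unfold timeMeasure; infer_instance
  have htm : t ∈ Icc 0 T := Ico_subset_Icc_self ht
  have h0m : (0 : ℝ) ∈ Icc 0 T := ⟨le_rfl, hT.le⟩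
  have hf : MemLp (fun r => ι (H₁ r - H₂ r)) 2 (timeMeasure T) := ι.comp_memLp' (hH₁.sub hH₂)
  have hf' : MemLp (fun r => ι (H₁' r - H₂' r)) 2 (timeMeasure T) :=
    ι.comp_memLp' (hH₁'.sub hH₂')
  have hint₁ := hH₁'.integrable one_le_two
  have hint₂ := hH₂'.integrable one_le_two
  have hprim : ∀ s ∈ Icc 0 T, ι (η₁ s - η₂ s) = ∫ r in 0..s, ι (H₁' r - H₂' r) := by
    intro s hs
    have i1 := intervalIntegrable_of_timeMeasure hint₁ h0m hs
    have i2 := intervalIntegrable_of_timeMeasure hint₂ h0m hs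
    rw [ι.intervalIntegral_comp_comm (i1.sub i2), intervalIntegral.integral_sub i1 i2,
      ← hd₁.sub_eq_integral hint₁ hT hη₁ hηH₁ hs, ← hd₂.sub_eq_integral hint₂ hT hη₂ hηH₂ hs, h0]
    congr 1
    abel
  have henergy := norm_sq_le_integral_inner (g := fun s => ι (η₁ s - η₂ s)) hT hf hf'
    (ι.continuous.comp_continuousOn (hη₁.sub hη₂)) (by
      filter_upwards [hηH₁, hηH₂] with r e1 e2
      rw [e1, e2]) hprim ht
  have iq : IntervalIntegrable (fun r => ‖Q r‖ ^ 2) volume 0 t :=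
    intervalIntegrable_of_timeMeasure (integrable_norm_sq hQ) h0m htm
  have ii : IntervalIntegrable (fun r => inner ℝ (ι (H₁' r - H₂' r)) (ι (H₁ r - H₂ r)))
      volume 0 t := by
    have hW : MemLp (fun r => innerSL ℝ (ι (H₁' r - H₂' r))) 2 (timeMeasure T) :=
      hf'.of_le ((innerSL ℝ).continuous.comp_aestronglyMeasurable hf'.1)
        (Eventually.of_forall fun r => (innerSL_apply_norm ℝ _).le)
    exact intervalIntegrable_of_timeMeasure (integrable_apply hW hf) h0m htm
  have hae : ∀ᵐ r ∂(timeMeasure T), inner ℝ (ι (H₁' r - H₂' r)) (ι (H₁ r - H₂ r)) ≤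
      L ^ 2 / (4 * τ) * ‖Q r‖ ^ 2 := by
    filter_upwards [he] with r key
    set a := ι (H₁' r - H₂' r)
    set b := ι (H₁ r - H₂ r)
    have h1 : inner ℝ (τ • a + b) b ≤ L * ‖Q r‖ * ‖b‖ :=
      (real_inner_le_norm _ _).trans (mul_le_mul_of_nonneg_right key (norm_nonneg _))
    rw [inner_add_left, real_inner_smul_left, real_inner_self_eq_norm_sq] at h1
    rw [div_mul_eq_mul_div, le_div_iff₀ (by positivity)]
    nlinarith [sq_nonneg (2 * ‖b‖ - L * ‖Q r‖)]
  have hmono := intervalIntegral_mono_of_timeMeasure ht ii (iq.const_mul _) hae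
  rw [intervalIntegral.integral_const_mul] at hmono
  have e : L ^ 2 / (2 * τ) = 2 * (L ^ 2 / (4 * τ)) := by
    field_simp
    norm_num
  rw [e, mul_assoc]
  exact henergy.trans (by linarith)

/-- Uniqueness for the coupling of a coercive equation with a relaxation equation: the two estimates
combine to a homogeneous Grönwall inequality for the difference of the coefficients. -/
theorem ae_eq_of_coercive_of_relaxation {E V P Y S : Type*} [NormedAddCommGroup E]
    [InnerProductSpace ℝ E] [NormedAddCommGroup V] [InnerProductSpace ℝ V] [NormedAddCommGroup P]
    [NormedSpace ℝ P] [NormedAddCommGroup Y] [NormedSpace ℝ Y] [CompleteSpace Y]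
    [NormedAddCommGroup S] [InnerProductSpace ℝ S] [CompleteSpace S]
    (K : V →L[ℝ] E) (D : V →L[ℝ] P) (ι : Y →L[ℝ] S)
    {T τ A B L : ℝ} (hT : 0 < T) (hτ : 0 < τ) (hB : 0 < B)
    {u₁ u₂ : ℝ → V} {u₁' u₂' : ℝ → StrongDual ℝ V} {H₁ H₂ H₁' H₂' : ℝ → Y} {x : E} {y : Y}
    (hu₁ : MemLp u₁ 2 (timeMeasure T)) (hu₂ : MemLp u₂ 2 (timeMeasure T))
    (hu₁' : MemLp u₁' 2 (timeMeasure T)) (hu₂' : MemLp u₂' 2 (timeMeasure T))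
    (hud₁ : HasWeakTimeDeriv T (fun t => (innerSL ℝ (K (u₁ t))).comp K) u₁')
    (hud₂ : HasWeakTimeDeriv T (fun t => (innerSL ℝ (K (u₂ t))).comp K) u₂')
    (hui₁ : HasInitialValue T (fun t => K (u₁ t)) x)
    (hui₂ : HasInitialValue T (fun t => K (u₂ t)) x)
    (hH₁ : MemLp H₁ 2 (timeMeasure T)) (hH₂ : MemLp H₂ 2 (timeMeasure T))
    (hH₁' : MemLp H₁' 2 (timeMeasure T)) (hH₂' : MemLp H₂' 2 (timeMeasure T))
    (hHd₁ : HasWeakTimeDeriv T H₁ H₁') (hHd₂ : HasWeakTimeDeriv T H₂ H₂')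
    (hHi₁ : HasInitialValue T H₁ y) (hHi₂ : HasInitialValue T H₂ y)
    (hue : ∀ᵐ r ∂(timeMeasure T), (u₁' r - u₂' r) (u₁ r - u₂ r) ≤
      A * ‖ι (H₁ r - H₂ r)‖ ^ 2 - B * ‖D (u₁ r - u₂ r)‖ ^ 2)
    (hHe : ∀ᵐ r ∂(timeMeasure T),
      ‖τ • ι (H₁' r - H₂' r) + ι (H₁ r - H₂ r)‖ ≤ L * ‖D (u₁ r - u₂ r)‖) :
    ∀ᵐ t ∂(timeMeasure T), K (u₁ t) = K (u₂ t) ∧ ι (H₁ t) = ι (H₂ t) := by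
  obtain ⟨g₁, hg₁, hgu₁, hg0₁⟩ := hui₁
  obtain ⟨g₂, hg₂, hgu₂, hg0₂⟩ := hui₂
  obtain ⟨η₁, hη₁, hηH₁, hη0₁⟩ := hHi₁
  obtain ⟨η₂, hη₂, hηH₂, hη0₂⟩ := hHi₂
  have hη : ContinuousOn (fun r => ι (η₁ r - η₂ r)) (Icc 0 T) :=
    ι.continuous.comp_continuousOn (hη₁.sub hη₂)
  set ρ : ℝ → ℝ := fun r => ‖ι (η₁ r - η₂ r)‖ ^ 2 with hρ
  have hue' : ∀ᵐ r ∂(timeMeasure T), (u₁' r - u₂' r) (u₁ r - u₂ r) ≤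
      A * ‖ι (η₁ r - η₂ r)‖ ^ 2 - B * ‖D (u₁ r - u₂ r)‖ ^ 2 := by
    filter_upwards [hue, hηH₁, hηH₂] with r e e1 e2
    rwa [e1, e2]
  have hdiff : ∀ t ∈ Ico 0 T, ‖g₁ t - g₂ t‖ ^ 2 +
      2 * B * ∫ r in 0..t, ‖D (u₁ r - u₂ r)‖ ^ 2 ≤ 2 * A * ∫ r in 0..t, ρ r :=
    fun t ht => norm_sub_sq_add_integral_le K D hT hu₁ hu₂ hu₁' hu₂' hud₁ hud₂ hg₁ hg₂ hgu₁ hgu₂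
      (hg0₁.trans hg0₂.symm) hη hue' ht
  have hrel : ∀ t ∈ Ico 0 T, ρ t ≤ L ^ 2 / (2 * τ) * ∫ r in 0..t, ‖D (u₁ r - u₂ r)‖ ^ 2 :=
    fun t ht => norm_sub_sq_le_of_relaxation ι hT hτ (D.comp_memLp' (hu₁.sub hu₂)) hH₁ hH₂ hH₁'
      hH₂' hHd₁ hHd₂ hη₁ hη₂ hηH₁ hηH₂ (hη0₁.trans hη0₂.symm) hHe ht
  have hρz : ∀ t ∈ Ico 0 T, ρ t = 0 := by
    refine fun t ht => eq_zero_of_le_mul_integral (C := L ^ 2 / (2 * τ) * (A / B)) (hη.norm.pow 2)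
      (fun r _ => sq_nonneg _) (fun s hs => ?_) ht
    have h1 : ∫ r in 0..s, ‖D (u₁ r - u₂ r)‖ ^ 2 ≤ A / B * ∫ r in 0..s, ρ r := by
      rw [div_mul_eq_mul_div, le_div_iff₀ hB]
      linarith [hdiff s hs, sq_nonneg ‖g₁ s - g₂ s‖]
    rw [mul_assoc]
    exact (hrel s hs).trans (mul_le_mul_of_nonneg_left h1 (by positivity))
  have hgz : ∀ t ∈ Ico 0 T, g₁ t = g₂ t := by
    intro t ht
    have h0 : ∫ r in 0..t, ρ r = 0 := by
      refine intervalIntegral.integral_zero_ae (Eventually.of_forall fun r hr => ?_)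
      rw [uIoc_of_le ht.1] at hr
      exact hρz r ⟨hr.1.le, hr.2.trans_lt ht.2⟩
    have h1 := hdiff t ht
    have h2 : 0 ≤ ∫ r in 0..t, ‖D (u₁ r - u₂ r)‖ ^ 2 :=
      intervalIntegral.integral_nonneg ht.1 fun r _ => sq_nonneg _
    rw [h0, mul_zero] at h1
    have h3 : ‖g₁ t - g₂ t‖ ^ 2 = 0 := by
      nlinarith [sq_nonneg ‖g₁ t - g₂ t‖, mul_nonneg hB.le h2]
    exact sub_eq_zero.1 (norm_eq_zero.1 (pow_eq_zero_iff two_ne_zero |>.1 h3))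
  filter_upwards [hgu₁, hgu₂, hηH₁, hηH₂, ae_restrict_mem measurableSet_Ioo] with t e1 e2 e3 e4 ht
  refine ⟨by rw [← e1, ← e2, hgz t ⟨ht.1.le, ht.2⟩], ?_⟩
  have h1 := norm_eq_zero.1 (pow_eq_zero_iff two_ne_zero |>.1 (hρz t ⟨ht.1.le, ht.2⟩))
  rwa [map_sub, sub_eq_zero, e3, e4] at h1

/-! ### Comparison of two weak solutions -/

theorem ResponseAssumption.exists_lipschitz {d k : ℕ} {F : Mat k d → SymTensor k d}
    (hF : ResponseAssumption F) : ∃ L : ℝ, ∀ D E, ‖F D - F E‖ ≤ L * ‖D - E‖ := by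
  obtain ⟨hcont, -, F', hF', c, hc, -, hbound⟩ := hF
  exact ⟨_, fun D E => norm_sub_le_of_isWeakPartial hcont hF' hc.le hbound D E⟩

section

variable {d k : ℕ} {G : Set (Space d)}

/-- The embedding of `V` into `L²(G, ℝ^k)` as a continuous linear map. -/
noncomputable def toL2L (G : Set (Space d)) (k : ℕ) : spaceV G k →L[ℝ] L2 G k :=
  (WithLp.fstL 2 ℝ (L2 G k) (L2Mat G k)).comp (spaceV G k).subtypeL

/-- The weak gradient as a continuous linear map. -/
noncomputable def gradL (G : Set (Space d)) (k : ℕ) : spaceV G k →L[ℝ] L2Mat G k :=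
  (WithLp.sndL 2 ℝ (L2 G k) (L2Mat G k)).comp (spaceV G k).subtypeL

theorem gradL_apply (u : spaceV G k) : gradL G k u = grad u := rfl

end

/-- Two weak solutions agree, as elements of the Lebesgue spaces on `G`, at almost every time. -/
theorem IsWeakSolution.ae_eq {d k : ℕ} {G : Set (Space d)} (hG : Bornology.IsBounded G)
    {T τ : ℝ} (hT : 0 < T) (hτ : 0 < τ) {F : Mat k d → SymTensor k d} (hF : ResponseAssumption F)
    {u₀ : spaceH G k} {H₀ : LinftySym G k} {u₁ u₂ : ℝ → spaceV G k} {H₁ H₂ : ℝ → LinftySym G k}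
    (h₁ : IsWeakSolution T τ F u₀ H₀ u₁ H₁) (h₂ : IsWeakSolution T τ F u₀ H₀ u₂ H₂)
    (hb₂ : HasBoundedGradient T u₂) :
    ∀ᵐ t ∂(timeMeasure T), toL2 (u₁ t) = toL2 (u₂ t) ∧ H₁ t = H₂ t := by
  have : IsFiniteMeasure ((volume : Measure (Space d)).restrict G) :=
    ⟨by simpa using hG.measure_lt_top⟩
  obtain ⟨L, hL⟩ := hF.exists_lipschitz
  obtain ⟨M, hM⟩ := hb₂
  obtain ⟨⟨κ, hκ, hκH⟩, hu₁, ⟨u₁', hu₁', hud₁, hue₁⟩, hH₁, ⟨H₁', hH₁', hHd₁, hHe₁⟩,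
    hui₁, hHi₁⟩ := h₁
  obtain ⟨-, hu₂, ⟨u₂', hu₂', hud₂, hue₂⟩, hH₂, ⟨H₂', hH₂', hHd₂, hHe₂⟩,
    hui₂, hHi₂⟩ := h₂
  have hue : ∀ᵐ r ∂(timeMeasure T), (u₁' r - u₂' r) (u₁ r - u₂ r) ≤
      M ^ 2 / (2 * κ) * ‖linftyToL2 (volume.restrict G) (H₁ r - H₂ r)‖ ^ 2 -
        κ / 2 * ‖gradL G k (u₁ r - u₂ r)‖ ^ 2 := by
    filter_upwards [hue₁, hue₂, hκH, hM] with r e1 e2 e3 e4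
    have key := le_aForm_sub_aForm (H₂ := H₂ r) (u₁ := u₁ r) hκ e3 e4
    have e1 := e1 (u₁ r - u₂ r)
    have e2 := e2 (u₁ r - u₂ r)
    rw [sub_apply, gradL_apply]
    linarith
  have hHe : ∀ᵐ r ∂(timeMeasure T), ‖τ • linftyToL2 (volume.restrict G) (H₁' r - H₂' r) +
      linftyToL2 (volume.restrict G) (H₁ r - H₂ r)‖ ≤ L * ‖gradL G k (u₁ r - u₂ r)‖ := by
    filter_upwards [hHe₁, hHe₂] with r e1 e2
    exact norm_relaxation_sub_le hL e1 e2
  have key := ae_eq_of_coercive_of_relaxation (E := L2 G k) (V := spaceV G k) (P := L2Mat G k)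
    (Y := LinftySym G k) (S := Lp (SymTensor k d) 2 (volume.restrict G)) (toL2L G k) (gradL G k)
    (linftyToL2 (volume.restrict G)) (x := u₀.1) (y := H₀) (u₁ := u₁) (u₂ := u₂) (u₁' := u₁')
    (u₂' := u₂') (H₁ := H₁) (H₂ := H₂) (H₁' := H₁') (H₂' := H₂') (A := M ^ 2 / (2 * κ)) (L := L)
    hT hτ (half_pos hκ) hu₁ hu₂
  have key := key hu₁' hu₂' hud₁ hud₂
    hui₁ hui₂ hH₁ hH₂ hH₁' hH₂' hHd₁ hHd₂ hHi₁ hHi₂ hue hHe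
  filter_upwards [key] with t ht
  exact ⟨ht.1, linftyToL2_injective ht.2⟩

end ImageFilter

theorem mainTheorem3 {d k : ℕ} {G : Set (ImageFilter.Space d)}
    (hG_open : IsOpen G) (hG_connected : IsConnected G) (hG_bounded : Bornology.IsBounded G)
    {T τ : ℝ} (hT : 0 < T) (hτ : 0 < τ)
    {F : ImageFilter.Mat k d → ImageFilter.SymTensor k d}
    (hF : ImageFilter.ResponseAssumption F)
    {u₀ : ImageFilter.spaceH G k} {H₀ : ImageFilter.LinftySym G k}
    {u₁ u₂ : ℝ → ImageFilter.spaceV G k} {H₁ H₂ : ℝ → ImageFilter.LinftySym G k}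
    (h₁ : ImageFilter.IsWeakSolution T τ F u₀ H₀ u₁ H₁)
    (h₂ : ImageFilter.IsWeakSolution T τ F u₀ H₀ u₂ H₂)
    (hb₁ : ImageFilter.HasBoundedGradient T u₁)
    (hb₂ : ImageFilter.HasBoundedGradient T u₂) :
    (∀ᵐ p ∂((volume.restrict (Ioo 0 T)).prod (volume.restrict G)),
      ImageFilter.toL2 (u₁ p.1) p.2 = ImageFilter.toL2 (u₂ p.1) p.2) ∧
    (∀ᵐ p ∂((volume.restrict (Ioo 0 T)).prod (volume.restrict G)),
      H₁ p.1 p.2 = H₂ p.1 p.2) := by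
  -- Equality in the Lebesgue spaces on `G` means that the chosen representatives are the same
  -- functions, so that the exceptional set is a null set of times.
  have key := ImageFilter.IsWeakSolution.ae_eq hG_bounded hT hτ hF h₁ h₂ hb₂
  constructor
  · filter_upwards [Measure.quasiMeasurePreserving_fst.ae key] with p hp
    rw [hp.1]
  · filter_upwards [Measure.quasiMeasurePreserving_fst.ae key] with p hp
    rw [hp.2]
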